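/- Let $F=(P,Q)\in\mathbb{C}[X,Y]^2$ satisfy the $Y$-degree condition $\deg F=\deg_Y P=\deg_Y Q$, where $\deg F=\max(\deg P,\deg Q)$ (no condition on the Jacobian is assumed). Let $A(F)\subseteq\mathbb{C}^2$ be the set of asymptotic values of $F$, i.e. of the points $w$ such that $F(\gamma(t))\to w$ as $t\to\infty$ for some smooth curve $\gamma:\mathbb{R}\to\mathbb{C}^2$ with $\gamma(t)\to\infty$ as $t\to\infty$. Then there is a finite set $R_0(F)$ of rational mappings of the form $$R(X,Y)=(X^{-\alpha},\,X^{\beta}Y+X^{-\alpha}\varphi(X)),\qquad \alpha\in\mathbb{Z}_{\ge 1},\ \beta\in\mathbb{Z}_{\ge 0},\ \varphi\in\mathbb{C}[X],\ \deg\varphi<\alpha+\beta,$$ where $\alpha$ and the exponents of $X$ that effectively appear in $X^{\alpha+\beta}Y+\varphi(X)$ have greatest common divisor $1$, with the following properties. Write $\mathrm{sing}(R)=\{X=0\}$. 1. For each $R\in R_0(F)$ there is a polynomial mapping $G_R\in\mathbb{C}[X,Y]^2$ with $G_R=F\circ R$ off $\mathrm{sing}(R)$. 2. Every $w\in A(F)$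 equals $G_R(0,Y_0)$ for some $R\in R_0(F)$ and some $Y_0\in\mathbb{C}$. 3. $A(F)$ is an algebraic subset of $\mathbb{C}^2$, $A(F)=\bigcup_{R\in R_0(F)}G_R(\mathrm{sing}(R))$, and $R\mapsto G_R(\mathrm{sing}(R))$ is a bijection from $R_0(F)$ onto the set of irreducible components of $A(F)$; in particular the number of elements of $R_0(F)$ is the number of irreducible components of $A(F)$. (So $R_0(F)$ is a geometric basis of $F$.) 4. If $\deg F\ge 1$, each $G_R(\mathrm{sing}(R))$, $R\in R_0(F)$, is an irreducible plane algebraic curve, i.e. the zero set of an irreducible polynomial. -/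

import Mathlib

open scoped ContDiff

/-- A pair `F = (P, Q)` of polynomials in `ℂ[X, Y]`; variable `0` is `X`, variable `1` is `Y`. -/
abbrev PolyPair : Type := Fin 2 → MvPolynomial (Fin 2) ℂ

/-- The polynomial mapping `ℂ² → ℂ²` defined by a pair of polynomials. -/
noncomputable def PolyPair.map (F : PolyPair) (z : Fin 2 → ℂ) : Fin 2 → ℂ :=
  fun i => MvPolynomial.eval z (F i)

/-- `deg F`, the larger of the total degrees of the two coordinates. -/
noncomputable def PolyPair.deg (F : PolyPair) : ℕ :=
  max (F 0).totalDegree (F 1).totalDegree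

/-- The `Y`-degree condition `deg F = deg_Y P = deg_Y Q`. -/
def PolyPair.YDegreeCondition (F : PolyPair) : Prop :=
  F.deg = (F 0).degreeOf 1 ∧ F.deg = (F 1).degreeOf 1

/-- `A(F)`: the limits of `F` along smooth curves tending to infinity. -/
def PolyPair.asymptoticVariety (F : PolyPair) : Set (Fin 2 → ℂ) :=
  {w | ∃ γ : ℝ → (Fin 2 → ℂ), ContDiff ℝ ∞ γ ∧
    Filter.Tendsto γ Filter.atTop (Filter.cocompact (Fin 2 → ℂ)) ∧
    Filter.Tendsto (fun t => F.map (γ t)) Filter.atTop (nhds w)}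

/-- The data of a rational mapping `R(X, Y) = (X ^ (-α), X ^ β * Y + X ^ (-α) * φ(X))` with
`α ≥ 1`, `β ≥ 0`, `deg φ < α + β`, which is primitive: `α` and the exponents of `X` that appear in
`X ^ (α + β) * Y + φ(X)` have no common factor. The mapping determines `α`, `β` and `φ`. -/
@[ext]
structure AsymptoticMap where
  α : ℕ
  β : ℕ
  φ : Polynomial ℂ
  α_pos : 0 < α
  degree_lt : φ.degree < ((α + β : ℕ) : WithBot ℕ)
  primitive : Nat.gcd α (Nat.gcd (α + β) (φ.support.gcd id)) = 1

/-- The value `R(x, y)`; it is meaningful for `x ≠ 0`. -/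
noncomputable def AsymptoticMap.map (R : AsymptoticMap) (z : Fin 2 → ℂ) : Fin 2 → ℂ :=
  ![(z 0 ^ R.α)⁻¹, z 0 ^ R.β * z 1 + (z 0 ^ R.α)⁻¹ * R.φ.eval (z 0)]

/-- The locus `X = 0` where `R` is not defined (each `R` has a pole there, as `α ≥ 1`). -/
def AsymptoticMap.sing (_R : AsymptoticMap) : Set (Fin 2 → ℂ) := {z | z 0 = 0}

/-- `G` is the `R`-dual of `F`: a polynomial mapping with `G = F ∘ R` off `sing R`. -/
def AsymptoticMap.IsDual (R : AsymptoticMap) (F G : PolyPair) : Prop :=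
  ∀ z : Fin 2 → ℂ, z ∉ R.sing → G.map z = F.map (R.map z)

/-- Algebraic subsets of `ℂ²`: common zero sets of families of polynomials. -/
def IsAlgebraicSubset (S : Set (Fin 2 → ℂ)) : Prop :=
  ∃ I : Set (MvPolynomial (Fin 2) ℂ), S = {z | ∀ f ∈ I, MvPolynomial.eval z f = 0}

/-- Irreducible algebraic subsets of `ℂ²`. -/
def IsIrreducibleAlgebraicSubset (S : Set (Fin 2 → ℂ)) : Prop :=
  IsAlgebraicSubset S ∧ S.Nonempty ∧
    ∀ Z₁ Z₂ : Set (Fin 2 → ℂ), IsAlgebraicSubset Z₁ → IsAlgebraicSubset Z₂ →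
      S ⊆ Z₁ ∪ Z₂ → S ⊆ Z₁ ∨ S ⊆ Z₂

/-- The irreducible components of an algebraic set `A`: its maximal irreducible algebraic
subsets. -/
def algebraicComponents (A : Set (Fin 2 → ℂ)) : Set (Set (Fin 2 → ℂ)) :=
  {C | Maximal (fun S => IsIrreducibleAlgebraicSubset S ∧ S ⊆ A) C}

/-- Irreducible plane algebraic curves: zero sets of irreducible polynomials. -/
def IsIrreduciblePlaneCurve (C : Set (Fin 2 → ℂ)) : Prop :=
  ∃ H : MvPolynomial (Fin 2) ℂ, Irreducible H ∧ C = {z | MvPolynomial.eval z H = 0}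

/-- `R₀`, with duals `G R` for `R ∈ R₀`, is a geometric basis of `F`: it has as many elements as
`A(F)` has irreducible components, each `G_R(sing R)` is an irreducible component of `A(F)`, these
sets cover `A(F)`, and each `F ∘ R` extends to the polynomial mapping `G_R`. -/
structure IsGeometricBasis (F : PolyPair) (R₀ : Set AsymptoticMap)
    (G : AsymptoticMap → PolyPair) : Prop where
  card_eq : R₀.encard = (algebraicComponents F.asymptoticVariety).encard
  component : ∀ R ∈ R₀, (G R).map '' R.sing ∈ algebraicComponents F.asymptoticVariety
  union_eq : F.asymptoticVariety = ⋃ R ∈ R₀, (G R).map '' R.sing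
  dual : ∀ R ∈ R₀, R.IsDual F (G R)

/-! The heart is a Newton–Puiseux resolution at infinity, run on sequences instead of power series.
Let `d = deg F > 0`. The degree condition puts a nonzero multiple of `Y ^ d` in both coordinates, so
where `F` converges while `z → ∞`, the first coordinate tends to infinity and `Y / X` converges
along an ultrafilter (`exists_tendsto_slope`). With `t = 1 / X` and `u = Y / X`, an asymptotic value
`w` becomes a limit of `t ^ (-d) * G(t, u)` for a polynomial pair `G`. `hasLimitChart_of_centered`
rescales by the smallest Newton slope, recentres at the limit and repeats, until a substitution `(t
^ α, φ(t) + t ^ k * y)` makes this quotient polynomial, nonconstant on `t = 0`, with value `w` at a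
point there. Removing a common factor of the exponents makes the substitution primitive
(`HasLimitChart.exists_primitive`), and comparing coefficients of `y ^ d` gives `k ≥ α`
(`le_of_evalEval_eq`), so `β = k - α`. Thus `w` lies on the image of `X = 0` under the dual of some
`R`. Conversely, every such image lies in `A(F)`: approach `X = 0` with `y` fixed
(`AsymptoticMap.IsDual.map_mem_asymptoticVariety`). These images are irreducible plane curves, with
no missing points because `ℂ[X]` is integral over the coordinate ring
(`isIrreduciblePlaneCurve_range`). Finiteness is independent of the resolution: a nonzero polynomial
vanishes on `A(F)` (`exists_vanishing`), so only the zero sets of its irreducible factors can occur.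
Irreducible curves contained in one another coincide, so the images are exactly the components, and
`R₀` selects one map for each of them. If `d = 0`, then `F` is constant and `A(F)` is a point. -/

/-! ### Tools for one Newton polygon step. -/

section NewtonStep

open Polynomial Filter Topology

lemma continuous_evalEval (p : ℂ[X][X]) :
    Continuous fun z : ℂ × ℂ => p.evalEval z.1 z.2 := by
  induction p using Polynomial.induction_on' with
  | add p q hp hq => simp only [evalEval_add]; exact hp.add hq
  | monomial n q =>
    have : (fun z : ℂ × ℂ => (monomial n q).evalEval z.1 z.2) =
        fun z : ℂ × ℂ => q.eval z.1 * z.2 ^ n := by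
      funext z
      simp [evalEval, eval_monomial]
    rw [this]
    exact (q.continuous.comp continuous_fst).mul (continuous_snd.pow n)

lemma tendsto_evalEval {ι : Type*} {l : Filter ι} {t y : ι → ℂ} {t₀ y₀ : ℂ} (p : ℂ[X][X])
    (ht : Tendsto t l (𝓝 t₀)) (hy : Tendsto y l (𝓝 y₀)) :
    Tendsto (fun i => p.evalEval (t i) (y i)) l (𝓝 (p.evalEval t₀ y₀)) :=
  ((continuous_evalEval p).tendsto (t₀, y₀)).comp (ht.prodMk_nhds hy)

/-- A bound for the roots of a polynomial in terms of bounds for its coefficients. -/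
lemma norm_le_of_norm_sum_le {m : ℕ} (hm : 0 < m) {a : ℕ → ℂ} {v : ℂ} {B δ : ℝ} (hδ : 0 < δ)
    (ha : ∀ j < m, ‖a j‖ ≤ B) (ham : δ ≤ ‖a m‖)
    (hs : ‖∑ j ∈ Finset.range (m + 1), a j * v ^ j‖ ≤ B) :
    ‖v‖ ≤ max 1 (B * (m + 1) / δ) := by
  by_contra! hv
  obtain ⟨hv1, hv2⟩ := max_lt_iff.1 hv
  have hB : 0 ≤ B := (norm_nonneg _).trans hs
  obtain ⟨n, rfl⟩ : ∃ n, m = n + 1 := ⟨m - 1, by omega⟩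
  rw [Finset.sum_range_succ] at hs
  have h1 : ‖∑ j ∈ Finset.range (n + 1), a j * v ^ j‖ ≤ (n + 1) * (B * ‖v‖ ^ n) := by
    refine (norm_sum_le_of_le _ (f := fun j => a j * v ^ j) (n := fun _ => B * ‖v‖ ^ n)
      fun j hj => ?_).trans (by simp)
    rw [norm_mul, norm_pow]
    have hj' := Finset.mem_range.1 hj
    exact mul_le_mul (ha j hj') (pow_le_pow_right₀ hv1.le (by omega)) (by positivity) hB
  have h2 : ‖a (n + 1) * v ^ (n + 1)‖ ≤ B + (n + 1) * (B * ‖v‖ ^ n) := by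
    have := norm_sub_le
      (∑ j ∈ Finset.range (n + 1), a j * v ^ j + a (n + 1) * v ^ (n + 1))
      (∑ j ∈ Finset.range (n + 1), a j * v ^ j)
    rw [add_sub_cancel_left] at this
    linarith
  have h3 : δ * ‖v‖ ^ (n + 1) ≤ ‖a (n + 1) * v ^ (n + 1)‖ := by
    rw [norm_mul, norm_pow]
    gcongr
  have h4 : B ≤ B * ‖v‖ ^ n := le_mul_of_one_le_right hB (one_le_pow₀ hv1.le)
  -- All terms other than the top one have size at most `B * ‖v‖ ^ n`, so this power cancels and
  -- bounds `‖v‖`.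
  have h5 : (δ * ‖v‖) * ‖v‖ ^ n ≤ (B * (n + 1 + 1)) * ‖v‖ ^ n := by
    calc _ = δ * ‖v‖ ^ (n + 1) := by ring
      _ ≤ B * ‖v‖ ^ n + (n + 1) * (B * ‖v‖ ^ n) := by linarith
      _ = _ := by ring
  have h6 := le_of_mul_le_mul_right h5 (by positivity)
  rw [div_lt_iff₀ hδ] at hv2
  push_cast at hv2
  linarith

/-- The smallest ratio in a finite set of positive fractions, in lowest terms. -/
lemma exists_coprime_min_ratio (T : Finset (ℕ × ℕ)) (hT : T.Nonempty)
    (hpos : ∀ x ∈ T, 0 < x.1 ∧ 0 < x.2) :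
    ∃ k l : ℕ, 0 < k ∧ 0 < l ∧ Nat.Coprime k l ∧ (∀ x ∈ T, k * x.2 ≤ l * x.1) ∧
      ∃ x ∈ T, k * x.2 = l * x.1 := by
  obtain ⟨x₀, hx₀, hmin⟩ := T.exists_min_image (fun x => (x.1 : ℚ) / x.2) hT
  obtain ⟨hp, hq⟩ := hpos x₀ hx₀
  have hg : 0 < Nat.gcd x₀.1 x₀.2 := Nat.gcd_pos_of_pos_left _ hp
  obtain ⟨k, hk⟩ := Nat.gcd_dvd_left x₀.1 x₀.2
  obtain ⟨l, hl⟩ := Nat.gcd_dvd_right x₀.1 x₀.2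
  have hk0 : 0 < k := by
    rcases Nat.eq_zero_or_pos k with h | h
    · rw [h] at hk; omega
    · exact h
  have hl0 : 0 < l := by
    rcases Nat.eq_zero_or_pos l with h | h
    · rw [h] at hl; omega
    · exact h
  have hkd : x₀.1 / Nat.gcd x₀.1 x₀.2 = k := Nat.div_eq_of_eq_mul_right hg hk
  have hld : x₀.2 / Nat.gcd x₀.1 x₀.2 = l := Nat.div_eq_of_eq_mul_right hg hl
  refine ⟨k, l, hk0, hl0, ?_, fun x hx => ?_, x₀, hx₀, ?_⟩
  · rw [← hkd, ← hld]
    exact Nat.coprime_div_gcd_div_gcd hg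
  · obtain ⟨hp', hq'⟩ := hpos x hx
    have h := hmin x hx
    rw [div_le_div_iff₀ (by exact_mod_cast hq) (by exact_mod_cast hq')] at h
    have h' : x₀.1 * x.2 ≤ x.1 * x₀.2 := by exact_mod_cast h
    refine Nat.le_of_mul_le_mul_left (c := Nat.gcd x₀.1 x₀.2) ?_ hg
    calc _ = (Nat.gcd x₀.1 x₀.2 * k) * x.2 := by ring
      _ = x₀.1 * x.2 := by rw [← hk]
      _ ≤ x.1 * x₀.2 := h'
      _ = x.1 * (Nat.gcd x₀.1 x₀.2 * l) := by rw [← hl]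
      _ = _ := by ring
  · apply Nat.eq_of_mul_eq_mul_left hg
    calc _ = (Nat.gcd x₀.1 x₀.2 * k) * x₀.2 := by ring
      _ = x₀.1 * x₀.2 := by rw [← hk]
      _ = x₀.1 * (Nat.gcd x₀.1 x₀.2 * l) := by rw [← hl]
      _ = _ := by ring

lemma evalEval_map_expand_comp (p : ℂ[X][X]) (k l : ℕ) (t y : ℂ) :
    ((p.map (expand ℂ l).toRingHom).comp (C (X ^ k) * X)).evalEval t y =
      p.evalEval (t ^ l) (t ^ k * y) := by
  induction p using Polynomial.induction_on' with
  | add p q hp hq =>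
    rw [Polynomial.map_add, add_comp, evalEval_add, evalEval_add, hp, hq]
  | monomial n q =>
    simp [evalEval, eval_monomial, expand_eval, mul_pow]

/-- The weighted blow-up `(t, y) ↦ (t ^ l, t ^ k * y)`, divided by a power of `t`. -/
lemma exists_weighted_blowup (p : ℂ[X][X]) (k l N : ℕ) (hl : 0 < l)
    (h : ∀ j i, (p.coeff j).coeff i ≠ 0 → N ≤ l * i + k * j) :
    ∃ q : ℂ[X][X],
      (∀ t y, p.evalEval (t ^ l) (t ^ k * y) = t ^ N * q.evalEval t y) ∧
      ∀ j, expand ℂ l (p.coeff j) * X ^ (k * j) = X ^ N * q.coeff j := by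
  set s : ℂ[X][X] := (p.map (expand ℂ l).toRingHom).comp (C (X ^ k) * X) with hs
  have hcoeff : ∀ j, s.coeff j = expand ℂ l (p.coeff j) * X ^ (k * j) := by
    intro j
    rw [hs, comp_C_mul_X_coeff, coeff_map, ← pow_mul]
    rfl
  have heval : ∀ t y, s.evalEval t y = p.evalEval (t ^ l) (t ^ k * y) := by
    intro t y
    exact evalEval_map_expand_comp p k l t y
  have hdvd : C (X ^ N) ∣ s := by
    rw [C_dvd_iff_dvd_coeff]
    intro j
    rw [hcoeff, X_pow_dvd_iff]
    intro n hn
    rw [coeff_mul_X_pow']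
    split_ifs with hkj
    · rw [coeff_expand hl]
      split_ifs with hd
      · by_contra hne
        have := h j _ hne
        rw [Nat.mul_div_cancel' hd] at this
        omega
      · rfl
    · rfl
  obtain ⟨q, hq⟩ := hdvd
  refine ⟨q, fun t y => ?_, fun j => ?_⟩
  · rw [← heval, hq, evalEval_mul, evalEval_C, eval_pow, eval_X]
  · rw [← hcoeff, hq, coeff_C_mul]

/-- Splitting off the terms of low degree in the outer variable. -/
lemma exists_eq_sum_add_X_pow_mul (p : ℂ[X][X]) (m : ℕ) :
    ∃ q : ℂ[X][X], q.coeff 0 = p.coeff m ∧ ∀ t y, p.evalEval t y =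
      ∑ j ∈ Finset.range m, (p.coeff j).eval t * y ^ j + y ^ m * q.evalEval t y := by
  have hdvd : X ^ m ∣ p - ∑ j ∈ Finset.range m, C (p.coeff j) * X ^ j := by
    rw [X_pow_dvd_iff]
    intro n hn
    simp [coeff_C_mul, coeff_X_pow, hn]
  obtain ⟨q, hq⟩ := hdvd
  rw [sub_eq_iff_eq_add] at hq
  refine ⟨q, ?_, fun t y => ?_⟩
  · have := congrArg (fun r => r.coeff m) hq
    simp only [coeff_add, finsetSum_coeff, coeff_C_mul, coeff_X_pow] at this
    rw [this, coeff_X_pow_mul']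
    simp [Finset.sum_ite_eq]
  · conv_lhs => rw [hq]
    simp only [evalEval_add, evalEval_mul, evalEval_finsetSum, evalEval_pow, evalEval_C, evalEval_X]
    exact add_comm _ _

end NewtonStep

/-! ### The Newton–Puiseux induction for a pair of polynomials. -/

section NewtonInduction

open Polynomial Filter Topology

/-- After the substitution `(t ^ α, φ(t) + t ^ k * y)`, the pair `t ^ (-e) * G` becomes a
polynomial pair which is nonconstant on `t = 0` and takes the value `w` there. -/
def HasLimitChart (G : Fin 2 → ℂ[X][X]) (e : ℕ) (w : Fin 2 → ℂ) : Prop :=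
  ∃ (α k : ℕ) (φ : ℂ[X]) (H : Fin 2 → ℂ[X][X]) (y₀ : ℂ), 0 < α ∧ 0 < k ∧ φ.degree < (k : ℕ) ∧
    (∀ a t y, t ≠ 0 → (G a).evalEval (t ^ α) (φ.eval t + t ^ k * y) =
      t ^ (α * e) * (H a).evalEval t y) ∧
    (∃ a j, 0 < j ∧ ((H a).coeff j).coeff 0 ≠ 0) ∧ ∀ a, (H a).evalEval 0 y₀ = w a

/-- Substitutions compose: the ramification indices multiply, and `φ` is multiplied by `t ^ (α *
k)`. The relation `l * e = k * m + e'` says that the extracted powers of `t` match. -/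
lemma HasLimitChart.of_blowup {G G' : Fin 2 → ℂ[X][X]} {e e' k l m : ℕ} {w : Fin 2 → ℂ}
    (hl : 0 < l) (he : l * e = k * m + e')
    (hG : ∀ a t y, (G a).evalEval (t ^ l) (t ^ k * y) = t ^ (k * m) * (G' a).evalEval t y)
    (h : HasLimitChart G' e' w) : HasLimitChart G e w := by
  obtain ⟨α, k', φ, H, y₀, hα, hk', hφ, hH, hne, hw⟩ := h
  refine ⟨l * α, α * k + k', X ^ (α * k) * φ, H, y₀, Nat.mul_pos hl hα, by omega, ?_, ?_, hne, hw⟩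
  · rw [degree_mul, degree_X_pow, Nat.cast_add]
    exact WithBot.add_lt_add_left (WithBot.natCast_ne_bot _) hφ
  · intro a t y ht
    have h1 := hG a (t ^ α) (φ.eval t + t ^ k' * y)
    rw [hH a t y ht] at h1
    calc _ = (G a).evalEval ((t ^ α) ^ l) ((t ^ α) ^ k * (φ.eval t + t ^ k' * y)) := by
          rw [← pow_mul, mul_comm α l, eval_mul, eval_pow, eval_X]
          congr 2
          ring
      _ = t ^ (α * (k * m + e')) * (H a).evalEval t y := by rw [h1]; ring
      _ = _ := by rw [← he]; congr 2; ring

/-- The centre `c` becomes a constant term of `φ`; the degree bound survives because a chart has `k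
> 0`. -/
lemma HasLimitChart.of_shift {G G' : Fin 2 → ℂ[X][X]} {e : ℕ} {w : Fin 2 → ℂ} (c : ℂ)
    (hG : ∀ a t y, (G' a).evalEval t y = (G a).evalEval t (c + y))
    (h : HasLimitChart G' e w) : HasLimitChart G e w := by
  obtain ⟨α, k, φ, H, y₀, hα, hk, hφ, hH, hne, hw⟩ := h
  refine ⟨α, k, C c + φ, H, y₀, hα, hk, ?_, fun a t y ht => ?_, hne, hw⟩
  · refine (degree_add_le _ _).trans_lt (max_lt (degree_C_le.trans_lt ?_) hφ)
    exact_mod_cast hk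
  · rw [← hH a t y ht, hG, eval_add, eval_C, add_assoc]

lemma evalEval_taylor (p : ℂ[X][X]) (c t y : ℂ) :
    (taylor (C c) p).evalEval t y = p.evalEval t (c + y) := by
  simp [evalEval, taylor_apply, eval_comp, add_comm]

lemma coeff_coeff_taylor (p : ℂ[X][X]) (c : ℂ) (n : ℕ) :
    ((taylor (C c) p).coeff n).coeff 0 = (taylor c (p.map (evalRingHom 0))).coeff n := by
  have h : (taylor (C c) p).map (evalRingHom 0) = taylor c (p.map (evalRingHom 0)) := by
    simp [taylor_apply, Polynomial.map_comp]
  rw [← h, coeff_map, coe_evalRingHom, coeff_zero_eq_eval_zero]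

lemma evalEval_zero_left (p : ℂ[X][X]) (y : ℂ) :
    p.evalEval 0 y = (p.map (evalRingHom 0)).eval y := by
  rw [eval_map, ← eval₂_evalRingHom]

/-- The order of vanishing at `c` of a nonzero family of polynomials. -/
lemma exists_order_taylor (r : Fin 2 → ℂ[X]) (c : ℂ) (hr : ∃ a, r a ≠ 0)
    (hc : ∀ a, (r a).eval c = 0) :
    ∃ m, 0 < m ∧ (∃ a, (taylor c (r a)).coeff m ≠ 0) ∧
      (∀ a, ∀ j < m, (taylor c (r a)).coeff j = 0) := by
  classical
  have hex : ∃ n, ∃ a, (taylor c (r a)).coeff n ≠ 0 := by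
    obtain ⟨a, ha⟩ := hr
    by_contra! h
    apply ha
    apply taylor_injective c
    ext n
    simp [h n a]
  refine ⟨Nat.find hex, ?_, Nat.find_spec hex, fun a j hj => ?_⟩
  · rw [Nat.find_pos]
    simp [taylor_coeff_zero, hc]
  · have := Nat.find_min hex hj
    push Not at this
    exact this a

/-- If a polynomial of degree at most `m` vanishes to order at least `m` at `c` and has a nonzero
coefficient of degree less than `m`, then its coefficient of degree `m - 1` is nonzero. -/
lemma coeff_pred_ne_zero_of_taylor {r : ℂ[X]} {c : ℂ} {m j : ℕ} (hdeg : ∀ n, m < n → r.coeff n = 0)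
    (hr : ∀ n < m, (taylor c r).coeff n = 0) (hjm : j < m) (hj : r.coeff j ≠ 0) :
    r.coeff (m - 1) ≠ 0 := by
  obtain ⟨n, rfl⟩ : ∃ n, m = n + 1 := ⟨m - 1, by omega⟩
  have hnat : r.natDegree ≤ n + 1 := natDegree_le_iff_coeff_eq_zero.2 hdeg
  have h1 : taylor c r = C ((taylor c r).coeff (n + 1)) * X ^ (n + 1) := by
    ext i
    rw [coeff_C_mul, coeff_X_pow]
    split_ifs with hi
    · simp [hi]
    · rw [mul_zero]
      rcases lt_or_gt_of_ne hi with h | h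
      · exact hr i h
      · exact coeff_eq_zero_of_natDegree_lt (by rw [natDegree_taylor]; omega)
  set b := (taylor c r).coeff (n + 1)
  -- The two vanishing conditions leave `r = b * (X - c) ^ m`. A nonzero lower coefficient excludes
  -- `c = 0`, and then the coefficient `-m * b * c` of degree `m - 1` is nonzero in characteristic
  -- zero.
  have h2 : r = C b * (X + C (-c)) ^ (n + 1) := by
    have h := congrArg (taylor (-c)) h1
    rw [taylor_taylor] at h
    simpa [taylor_apply] using h
  have hb : b ≠ 0 := by
    rintro h
    rw [h2, h] at hj
    simp at hj
  have hc : c ≠ 0 := by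
    rintro rfl
    rw [h2, coeff_C_mul] at hj
    simp [coeff_X_pow] at hj
    omega
  rw [Nat.add_sub_cancel, h2, coeff_C_mul, coeff_X_add_C_pow]
  simp [hb, hc]
  exact_mod_cast Nat.succ_ne_zero n

/-- Descent on `(m, e)` in lexicographic order, where `m` is the order of the pair at `y = 0` on `t
= 0`. After blowing up, the restriction to `t = 0` has degree `m`, so its order at the new centre is
at most `m`. If the order does not drop, the restriction of some coordinate is `b * (z - c) ^ m`
with `b, c ≠ 0`; its term of degree `m - 1` forces `l = 1`, and `e` drops to `e - k * m`. The roots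
`τ` of `t` need no continuity, since only limits along `u` are taken. -/
theorem hasLimitChart_of_centered {ι : Type*} (u : Ultrafilter ι) (m : ℕ) (hm : 0 < m) :
    ∀ (e : ℕ), 0 < e → ∀ (G : Fin 2 → ℂ[X][X]) (t y : ι → ℂ) (w : Fin 2 → ℂ),
      (∃ a, ((G a).coeff m).coeff 0 ≠ 0) → (∀ a, ∀ j < m, ((G a).coeff j).coeff 0 = 0) →
      (∀ᶠ i in u, t i ≠ 0) → Tendsto t u (𝓝 0) → Tendsto y u (𝓝 0) →
      (∀ a, Tendsto (fun i => (G a).evalEval (t i) (y i) / t i ^ e) u (𝓝 (w a))) →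
      HasLimitChart G e w := by
  induction m using Nat.strong_induction_on with
  | _ m ihm =>
  intro e
  induction e using Nat.strong_induction_on with
  | _ e ihe =>
  intro he G t y w hGm hGlt ht0 ht hy hlim
  -- the smallest slope of the Newton polygon
  classical
  -- The extra point `(e, m)` stands for a monomial `t ^ e`, as if `w * t ^ e` were subtracted from
  -- `G`. It caps the slope, so the blow-up never extracts more than the power `t ^ e`.
  let T : Finset (ℕ × ℕ) := insert (e, m) (Finset.univ.biUnion fun a : Fin 2 =>
    (Finset.range m).biUnion fun j => ((G a).coeff j).support.image fun i => (i, m - j))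
  have hT : ∀ x, x ∈ T ↔ x = (e, m) ∨
      ∃ a, ∃ j < m, ∃ i, ((G a).coeff j).coeff i ≠ 0 ∧ (i, m - j) = x := by
    intro x
    simp [T, -Fin.exists_fin_two]
  obtain ⟨k, l, hk, hl, hkl, hle, x, hxT, hxeq⟩ := exists_coprime_min_ratio T
    ⟨(e, m), (hT _).2 (Or.inl rfl)⟩ (by
      intro x hx
      rcases (hT x).1 hx with rfl | ⟨a, j, hj, i, hi, rfl⟩
      · exact ⟨he, hm⟩
      · refine ⟨Nat.pos_of_ne_zero ?_, Nat.sub_pos_of_lt hj⟩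
        rintro rfl
        exact hi (hGlt a j hj))
  have hsupp : ∀ a j i, ((G a).coeff j).coeff i ≠ 0 → k * m ≤ l * i + k * j := by
    intro a j i hi
    rcases lt_or_ge j m with hj | hj
    · have := hle _ ((hT _).2 (Or.inr ⟨a, j, hj, i, hi, rfl⟩))
      simp only [Nat.mul_sub] at this
      omega
    · exact (Nat.mul_le_mul_left k hj).trans (Nat.le_add_left _ _)
  obtain ⟨e', he'⟩ : ∃ e', l * e = k * m + e' :=
    Nat.exists_eq_add_of_le (hle _ ((hT _).2 (Or.inl rfl)))
  choose G' hG' hcoeff using fun a => exists_weighted_blowup (G a) k l (k * m) hl (hsupp a)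
  -- coefficients of the blow-up at `t = 0`
  have hr : ∀ a j, ((G' a).coeff j).coeff 0 =
      (expand ℂ l ((G a).coeff j) * X ^ (k * j)).coeff (k * m) := by
    intro a j
    rw [hcoeff, coeff_X_pow_mul']
    simp
  have hrm : ∀ a, ((G' a).coeff m).coeff 0 = ((G a).coeff m).coeff 0 := by
    intro a
    rw [hr, coeff_mul_X_pow']
    simp [coeff_expand hl]
  have hrgt : ∀ a j, m < j → ((G' a).coeff j).coeff 0 = 0 := by
    intro a j hj
    rw [hr, coeff_mul_X_pow', if_neg]
    have := Nat.mul_lt_mul_of_pos_left hj hk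
    omega
  -- the new coordinates
  choose τ hτ using fun i => IsAlgClosed.exists_pow_nat_eq (t i) hl
  have hτ0 : ∀ᶠ i in u, τ i ≠ 0 := by
    filter_upwards [ht0] with i hi h
    apply hi
    rw [← hτ, h, zero_pow hl.ne']
  have hτlim : Tendsto τ u (𝓝 0) := by
    rw [Metric.tendsto_nhds] at ht ⊢
    intro ε hε
    filter_upwards [ht (ε ^ l) (by positivity)] with i hi
    rw [dist_zero_right] at hi ⊢
    rw [← hτ, norm_pow] at hi
    exact lt_of_pow_lt_pow_left₀ l hε.le hi
  let z : ι → ℂ := fun i => y i / τ i ^ k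
  have hz : ∀ᶠ i in u, τ i ^ k * z i = y i := by
    filter_upwards [hτ0] with i hi
    exact mul_div_cancel₀ _ (pow_ne_zero k hi)
  have hlim' : ∀ a, Tendsto (fun i => (G' a).evalEval (τ i) (z i) / τ i ^ e') u (𝓝 (w a)) := by
    intro a
    refine (hlim a).congr' ?_
    filter_upwards [hτ0, hz] with i hi hzi
    have h1 := hG' a (τ i) (z i)
    rw [hτ, hzi] at h1
    rw [h1]
    nth_rewrite 1 [← hτ i]
    rw [← pow_mul, he', pow_add]
    have := pow_ne_zero (k * m) hi
    have := pow_ne_zero e' hi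
    field_simp
  -- The factor `0 ^ e'` treats both cases at once: the limit is `w a` if `e' = 0`, and `0`
  -- otherwise.
  have hval : ∀ a, Tendsto (fun i => (G' a).evalEval (τ i) (z i)) u (𝓝 (w a * 0 ^ e')) := by
    intro a
    refine ((hlim' a).mul (hτlim.pow e')).congr' ?_
    filter_upwards [hτ0] with i hi
    exact div_mul_cancel₀ _ (pow_ne_zero _ hi)
  -- `z` is bounded, hence converges along the ultrafilter
  obtain ⟨c, hc⟩ : ∃ c, Tendsto z u (𝓝 c) := by
    obtain ⟨a, ha⟩ := hGm
    -- All terms of degree at least `m` are kept together as `z ^ m * q(t, y)`: it is not yet known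
    -- that `z` is bounded, but `y → 0`, so `q` tends to the nonzero coefficient of `y ^ m` at `t =
    -- 0`.
    obtain ⟨q, hq0, hq⟩ := exists_eq_sum_add_X_pow_mul (G a) m
    have hid : ∀ᶠ i in u, (G' a).evalEval (τ i) (z i) =
        ∑ j ∈ Finset.range m, ((G' a).coeff j).eval (τ i) * z i ^ j +
          z i ^ m * q.evalEval (t i) (y i) := by
      filter_upwards [hτ0, hz] with i hi hzi
      apply mul_left_cancel₀ (pow_ne_zero (k * m) hi)
      rw [← hG', hτ, hzi, hq, mul_add, Finset.mul_sum, ← hzi]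
      congr 1
      · refine Finset.sum_congr rfl fun j _ => ?_
        have := congrArg (eval (τ i)) (hcoeff a j)
        simp only [eval_mul, expand_eval, eval_pow, eval_X, hτ] at this
        rw [← mul_assoc, ← this]
        ring
      · ring
    have hqlim := tendsto_evalEval q ht hy
    rw [evalEval, ← coeff_zero_eq_eval_zero, C_0, ← coeff_zero_eq_eval_zero, hq0] at hqlim
    have hδ : 0 < ‖((G a).coeff m).coeff 0‖ / 2 := by positivity
    have hq1 : ∀ᶠ i in u, ‖((G a).coeff m).coeff 0‖ / 2 ≤ ‖q.evalEval (t i) (y i)‖ :=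
      hqlim.norm.eventually (Ici_mem_nhds (by linarith))
    have hcb : ∀ j, ∃ B, ∀ᶠ i in u, ‖((G' a).coeff j).eval (τ i)‖ ≤ B := fun j =>
      ⟨_, ((((G' a).coeff j).continuous.tendsto 0).comp hτlim).norm.eventually
        (Iic_mem_nhds (lt_add_one _))⟩
    choose B hB using hcb
    have hvb := (hval a).norm.eventually (Iic_mem_nhds (lt_add_one _))
    set B₀ := ‖w a * 0 ^ e'‖ + 1
    set M := B₀ + ∑ j ∈ Finset.range m, |B j|
    have hzb : ∀ᶠ i in u, z i ∈ Metric.closedBall (0 : ℂ)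
        (max 1 (M * (m + 1) / (‖((G a).coeff m).coeff 0‖ / 2))) := by
      have hBall : ∀ᶠ i in u, ∀ j ∈ Finset.range m, ‖((G' a).coeff j).eval (τ i)‖ ≤ B j :=
        (Filter.eventually_all_finset _).2 fun j _ => hB j
      filter_upwards [hid, hq1, hvb, hBall] with i hid hq1 hvb hBall
      rw [mem_closedBall_zero_iff]
      have hsum : 0 ≤ ∑ j ∈ Finset.range m, |B j| := Finset.sum_nonneg fun _ _ => abs_nonneg _
      refine norm_le_of_norm_sum_le hm (a := fun j => if j < m then
        ((G' a).coeff j).eval (τ i) else q.evalEval (t i) (y i)) hδ (fun j hj => ?_) ?_ ?_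
      · simp only [hj, if_true]
        refine (hBall j (Finset.mem_range.2 hj)).trans ((le_abs_self _).trans ?_)
        refine (Finset.single_le_sum (f := fun j => |B j|) (fun _ _ => abs_nonneg _)
          (Finset.mem_range.2 hj)).trans ?_
        have : 0 ≤ B₀ := by positivity
        linarith
      · simpa using hq1
      · rw [Finset.sum_range_succ, if_neg (lt_irrefl m), Finset.sum_congr rfl
          (g := fun j => ((G' a).coeff j).eval (τ i) * z i ^ j)
          fun j hj => by rw [if_pos (Finset.mem_range.1 hj)], mul_comm (evalEval _ _ _), ← hid]
        exact le_trans hvb (le_add_of_nonneg_right hsum)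
    obtain ⟨c, -, hc⟩ := (isCompact_closedBall (0 : ℂ) _).ultrafilter_le_nhds
      (u.map z) (le_principal_iff.2 hzb)
    exact ⟨c, hc⟩
  have hev : ∀ a, (G' a).evalEval 0 c = w a * 0 ^ e' := fun a =>
    tendsto_nhds_unique (tendsto_evalEval (G' a) hτlim hc) (hval a)
  rcases Nat.eq_zero_or_pos e' with rfl | hepos
  · obtain ⟨a, ha⟩ := hGm
    refine ⟨l, k, 0, G', c, hl, hk, by simp, fun a t y _ => ?_, ⟨a, m, hm, ?_⟩, fun a => ?_⟩
    · rw [eval_zero, zero_add, hG', he', add_zero]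
    · rwa [hrm]
    · simpa using hev a
  · refine HasLimitChart.of_blowup hl he' hG' ?_
    obtain ⟨m', hm'0, hm'1, hm'2⟩ := exists_order_taylor
      (fun a => (G' a).map (evalRingHom 0)) c (by
        obtain ⟨a, ha⟩ := hGm
        refine ⟨a, fun h => ha ?_⟩
        rw [← hrm, coeff_zero_eq_eval_zero, ← coe_evalRingHom, ← coeff_map, h, coeff_zero])
      (fun a => by rw [← evalEval_zero_left, hev, zero_pow hepos.ne', mul_zero])
    have hc0 : ∀ a j, ((G' a).map (evalRingHom 0)).coeff j = ((G' a).coeff j).coeff 0 := by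
      intro a j
      rw [coeff_map, coe_evalRingHom, coeff_zero_eq_eval_zero]
    have hshift : HasLimitChart (fun a => taylor (C c) (G' a)) e' w := by
      have hz0 : Tendsto (fun i => z i - c) u (𝓝 0) := by
        simpa using hc.sub_const c
      have hlim'' : ∀ a, Tendsto (fun i => (taylor (C c) (G' a)).evalEval (τ i) (z i - c) /
          τ i ^ e') u (𝓝 (w a)) := by
        intro a
        simpa only [evalEval_taylor, add_sub_cancel] using hlim' a
      have hA : ∃ a, ((taylor (C c) (G' a)).coeff m').coeff 0 ≠ 0 := by
        simpa only [coeff_coeff_taylor] using hm'1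
      have hB : ∀ a, ∀ j < m', ((taylor (C c) (G' a)).coeff j).coeff 0 = 0 := by
        simpa only [coeff_coeff_taylor] using hm'2
      have hle' : m' ≤ m := by
        by_contra! hlt
        obtain ⟨a, ha⟩ := hm'1
        refine ha (coeff_eq_zero_of_natDegree_lt ?_)
        rw [natDegree_taylor]
        refine lt_of_le_of_lt (natDegree_le_iff_coeff_eq_zero.2 fun j hj => ?_) hlt
        rw [hc0, hrgt a j hj]
      rcases hle'.lt_or_eq with hlt | rfl
      · exact ihm m' hlt hm'0 e' hepos _ τ _ w hA hB hτ0 hτlim hz0 hlim''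
      · refine ihe e' ?_ hepos _ τ _ w hA hB hτ0 hτlim hz0 hlim''
        -- Without ramification `e' = e - k * m < e`, which is what the inner induction needs.
        suffices hl1 : l = 1 by
          have := Nat.mul_pos hk hm
          rw [hl1] at he'
          omega
        -- If `(e, m)` attained the minimal ratio, `e'` would be `0`. So a genuine monomial with `j
        -- < m` does, and it survives at `t = 0`.
        rcases (hT x).1 hxT with rfl | ⟨a, j, hj, i, hi, rfl⟩
        · simp only at hxeq
          omega
        · have hkj : k * j ≤ k * m' := Nat.mul_le_mul_left k hj.le
          simp only [Nat.mul_sub] at hxeq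
          have h1 : ((G' a).coeff j).coeff 0 ≠ 0 := by
            rw [hr, coeff_mul_X_pow', if_pos hkj, hxeq, coeff_expand hl, if_pos (Dvd.intro _ rfl),
              Nat.mul_div_cancel_left _ hl]
            exact hi
          have h2 := coeff_pred_ne_zero_of_taylor (r := (G' a).map (evalRingHom 0)) (c := c)
            (fun n hn => by rw [hc0, hrgt a n hn]) (hm'2 a) hj (by rwa [hc0])
          rw [hc0, hr, coeff_mul_X_pow', if_pos (Nat.mul_le_mul_left k (Nat.sub_le _ _)),
            coeff_expand hl] at h2
          -- A surviving term of degree `m' - 1` comes from the exponent `k` of a polynomial in `t ^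
          -- l`; hence `l ∣ k`, against coprimality unless `l = 1`.
          have h3 : l ∣ k * m' - k * (m' - 1) := by
            by_contra h
            exact h2 (if_neg h)
          have h4 : k * m' - k * (m' - 1) = k := by
            rw [← Nat.mul_sub, Nat.sub_sub_self hm]; exact Nat.mul_one k
          rw [h4] at h3
          exact Nat.eq_one_of_dvd_coprimes hkl h3 dvd_rfl
    exact hshift.of_shift c fun a t y => evalEval_taylor _ _ _ _

/-- The case of sequences that converge to an arbitrary point of `t = 0`. -/
theorem hasLimitChart_of_tendsto {ι : Type*} (u : Ultrafilter ι) {e : ℕ} (he : 0 < e)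
    {G : Fin 2 → ℂ[X][X]} {t y : ι → ℂ} {w : Fin 2 → ℂ} {c : ℂ}
    (hG : ∃ a j, ((G a).coeff j).coeff 0 ≠ 0)
    (ht0 : ∀ᶠ i in u, t i ≠ 0) (ht : Tendsto t u (𝓝 0)) (hy : Tendsto y u (𝓝 c))
    (hlim : ∀ a, Tendsto (fun i => (G a).evalEval (t i) (y i) / t i ^ e) u (𝓝 (w a))) :
    HasLimitChart G e w := by
  have hev : ∀ a, (G a).evalEval 0 c = 0 := by
    intro a
    refine tendsto_nhds_unique (tendsto_evalEval (G a) ht hy) ?_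
    have h := (hlim a).mul (ht.pow e)
    rw [zero_pow he.ne', mul_zero] at h
    refine h.congr' ?_
    filter_upwards [ht0] with i hi
    exact div_mul_cancel₀ _ (pow_ne_zero _ hi)
  obtain ⟨m, hm0, hm1, hm2⟩ := exists_order_taylor
    (fun a => (G a).map (evalRingHom 0)) c (by
      obtain ⟨a, j, ha⟩ := hG
      refine ⟨a, fun h => ha ?_⟩
      rw [coeff_zero_eq_eval_zero, ← coe_evalRingHom, ← coeff_map, h, coeff_zero])
    (fun a => by rw [← evalEval_zero_left, hev])
  have hshift : HasLimitChart (fun a => taylor (C c) (G a)) e w := by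
    refine hasLimitChart_of_centered u m hm0 e he _ t (fun i => y i - c) w ?_ ?_ ht0 ht ?_ ?_
    · simpa only [coeff_coeff_taylor] using hm1
    · simpa only [coeff_coeff_taylor] using hm2
    · simpa using hy.sub_const c
    · intro a
      simpa only [evalEval_taylor, add_sub_cancel] using hlim a
  exact hshift.of_shift c fun a t y => evalEval_taylor _ _ _ _

end NewtonInduction

/-! ### Coordinates at infinity and the role of the degree condition. -/

section Infinity

open Polynomial Filter Topology

/-- The homogenization of degree `d` of a polynomial in two variables, as a function. -/
noncomputable def homogEval (d : ℕ) (p : MvPolynomial (Fin 2) ℂ) (r x y : ℂ) : ℂ :=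
  ∑ v ∈ p.support, p.coeff v * r ^ (d - (v 0 + v 1)) * x ^ v 0 * y ^ v 1

/-- The polynomial `s ^ d * p(1 / s, u / s)`. -/
noncomputable def chartAtInfinity (d : ℕ) (p : MvPolynomial (Fin 2) ℂ) : ℂ[X][X] :=
  ∑ v ∈ p.support, monomial (v 1) (monomial (d - (v 0 + v 1)) (p.coeff v))

lemma evalEval_chartAtInfinity (d : ℕ) (p : MvPolynomial (Fin 2) ℂ) (s u : ℂ) :
    (chartAtInfinity d p).evalEval s u = homogEval d p s 1 u := by
  rw [chartAtInfinity, homogEval, evalEval_finsetSum]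
  refine Finset.sum_congr rfl fun v _ => ?_
  simp [evalEval, eval_monomial]

lemma add_le_of_mem_support {d : ℕ} {p : MvPolynomial (Fin 2) ℂ} (hp : p.totalDegree ≤ d)
    {v : Fin 2 →₀ ℕ} (hv : v ∈ p.support) : v 0 + v 1 ≤ d := by
  refine le_trans ?_ ((MvPolynomial.le_totalDegree hv).trans hp)
  rw [Finsupp.sum_fintype _ _ fun _ => rfl, Fin.sum_univ_two]

lemma homogEval_eq {d : ℕ} {p : MvPolynomial (Fin 2) ℂ} (hp : p.totalDegree ≤ d)
    {r : ℂ} (hr : r ≠ 0) (x y : ℂ) :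
    homogEval d p r x y = r ^ d * MvPolynomial.eval ![x / r, y / r] p := by
  rw [homogEval, MvPolynomial.eval_eq', Finset.mul_sum]
  refine Finset.sum_congr rfl fun v hv => ?_
  obtain ⟨n, hn⟩ := Nat.exists_eq_add_of_le (add_le_of_mem_support hp hv)
  have h : d - (v 0 + v 1) = n := by omega
  rw [h, hn, Fin.prod_univ_two]
  simp only [Matrix.cons_val_zero, Matrix.cons_val_one, div_pow, pow_add]
  field_simp

lemma continuous_homogEval (d : ℕ) (p : MvPolynomial (Fin 2) ℂ) :
    Continuous fun z : ℂ × ℂ × ℂ => homogEval d p z.1 z.2.1 z.2.2 := by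
  unfold homogEval
  fun_prop

lemma eq_single_of_mem_support {d : ℕ} {p : MvPolynomial (Fin 2) ℂ} (hp : p.totalDegree ≤ d)
    {v : Fin 2 →₀ ℕ} (hv : v ∈ p.support) (h1 : d ≤ v 1) : v = Finsupp.single 1 d := by
  have := add_le_of_mem_support hp hv
  ext i
  fin_cases i
  · simp; omega
  · simp; omega

lemma homogEval_zero_zero {d : ℕ} {p : MvPolynomial (Fin 2) ℂ} (hp : p.totalDegree ≤ d) (b : ℂ) :
    homogEval d p 0 0 b = p.coeff (Finsupp.single 1 d) * b ^ d := by
  rw [homogEval, Finset.sum_eq_single (Finsupp.single 1 d)]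
  · simp
  · intro v hv hne
    have hlt : v 1 < d := by
      by_contra! h
      exact hne (eq_single_of_mem_support hp hv h)
    rcases Nat.eq_zero_or_pos (v 0) with h | h
    · have : d - (v 0 + v 1) ≠ 0 := by omega
      simp [this]
    · simp [h.ne']
  · intro h
    simp [MvPolynomial.notMem_support_iff.1 h]

lemma coeff_chartAtInfinity {d : ℕ} {p : MvPolynomial (Fin 2) ℂ} (hp : p.totalDegree ≤ d) :
    (chartAtInfinity d p).coeff d = C (p.coeff (Finsupp.single 1 d)) := by
  rw [chartAtInfinity, finsetSum_coeff, Finset.sum_eq_single (Finsupp.single 1 d)]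
  · simp
  · intro v hv hne
    rw [coeff_monomial, if_neg]
    intro h
    exact hne (eq_single_of_mem_support hp hv h.ge)
  · intro h
    simp [MvPolynomial.notMem_support_iff.1 h]

lemma natDegree_chartAtInfinity_le {d : ℕ} {p : MvPolynomial (Fin 2) ℂ}
    (hp : p.totalDegree ≤ d) : (chartAtInfinity d p).natDegree ≤ d := by
  refine natDegree_sum_le_of_forall_le _ _ fun v hv => (natDegree_monomial_le _).trans ?_
  have := add_le_of_mem_support hp hv
  omega

lemma coeff_single_ne_zero {d : ℕ} (hd : 0 < d) {p : MvPolynomial (Fin 2) ℂ}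
    (hp : p.totalDegree ≤ d) (h : d = p.degreeOf 1) : p.coeff (Finsupp.single 1 d) ≠ 0 := by
  have hsup : ∃ v ∈ p.support, d ≤ v 1 := by
    by_contra! hlt
    rw [h] at hlt hd
    exact lt_irrefl _ ((MvPolynomial.degreeOf_lt_iff hd).2 hlt)
  obtain ⟨v, hv, hv1⟩ := hsup
  rw [← eq_single_of_mem_support hp hv hv1]
  exact MvPolynomial.mem_support_iff.1 hv

/-- If `p` is monic in `Y` up to a constant, of `Y`-degree equal to its total degree, and `p` has a
limit along `z → ∞`, then `X → ∞` and `Y / X` converges. -/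
lemma exists_tendsto_slope {ι : Type*} (u : Ultrafilter ι) {d : ℕ} (hd : 0 < d)
    {p : MvPolynomial (Fin 2) ℂ} (hp : p.totalDegree ≤ d)
    (hc : p.coeff (Finsupp.single 1 d) ≠ 0) {z : ι → Fin 2 → ℂ}
    (hz : Tendsto z u (cocompact (Fin 2 → ℂ))) {w : ℂ}
    (hw : Tendsto (fun i => MvPolynomial.eval (z i) p) u (𝓝 w)) :
    (∀ᶠ i in u, z i 0 ≠ 0) ∧ Tendsto (fun i => (z i 0)⁻¹) u (𝓝 0) ∧
      ∃ c, Tendsto (fun i => z i 1 / z i 0) u (𝓝 c) := by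
  have hnorm : Tendsto (fun i => ‖z i‖) u atTop := (tendsto_norm_cocompact_atTop).comp hz
  have hpos : ∀ᶠ i in u, 0 < ‖z i‖ := hnorm.eventually_gt_atTop 0
  let r : ι → ℂ := fun i => ((‖z i‖ : ℝ) : ℂ)⁻¹
  have hr : Tendsto r u (𝓝 0) := by
    have := (Complex.continuous_ofReal.tendsto 0).comp (tendsto_inv_atTop_zero.comp hnorm)
    simpa [r, Function.comp_def] using this
  have hr0 : ∀ᶠ i in u, r i ≠ 0 := by
    filter_upwards [hpos] with i hi
    simpa [r] using hi
  -- Normalizing to the unit sphere gives a limit direction `ζ₀`. As `r ^ d * p(z) → 0`, the form of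
  -- degree `d` of `p` vanishes there; its nonzero `Y ^ d` coefficient rules out `ζ₀ 0 = 0`.
  let ζ : ι → Fin 2 → ℂ := fun i => r i • z i
  have hζ : ∀ᶠ i in u, ‖ζ i‖ = 1 := by
    filter_upwards [hpos] with i hi
    simp only [ζ, r, norm_smul, norm_inv, Complex.norm_real, norm_norm]
    exact inv_mul_cancel₀ hi.ne'
  obtain ⟨ζ₀, -, hζ₀⟩ := (isCompact_closedBall (0 : Fin 2 → ℂ) 1).ultrafilter_le_nhds
    (u.map ζ) (le_principal_iff.2 (by
      change ∀ᶠ i in u, ζ i ∈ Metric.closedBall 0 1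
      filter_upwards [hζ] with i hi
      simp only [mem_closedBall_zero_iff, hi, le_refl]))
  have hζlim : Tendsto ζ u (𝓝 ζ₀) := hζ₀
  have hζ1 : ‖ζ₀‖ = 1 :=
    tendsto_nhds_unique hζlim.norm (tendsto_const_nhds.congr' (hζ.mono fun i hi => hi.symm))
  have h0 := (tendsto_pi_nhds.1 hζlim) 0
  have h1 := (tendsto_pi_nhds.1 hζlim) 1
  have hval : homogEval d p 0 (ζ₀ 0) (ζ₀ 1) = 0 := by
    have ht := ((continuous_homogEval d p).tendsto (0, ζ₀ 0, ζ₀ 1)).comp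
      (hr.prodMk_nhds (h0.prodMk_nhds h1))
    refine tendsto_nhds_unique ht ?_
    have h2 := (hr.pow d).mul hw
    rw [zero_pow hd.ne', zero_mul] at h2
    refine h2.congr' ?_
    filter_upwards [hr0] with i hi
    simp only [Function.comp_apply, ζ, Pi.smul_apply, smul_eq_mul]
    rw [homogEval_eq hp hi, mul_div_cancel_left₀ _ hi, mul_div_cancel_left₀ _ hi]
    rw [show ![z i 0, z i 1] = z i from funext fun j => by fin_cases j <;> rfl]
  have ha : ζ₀ 0 ≠ 0 := by
    intro ha
    rw [ha, homogEval_zero_zero hp] at hval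
    have hb : ζ₀ 1 = 0 := by
      rcases mul_eq_zero.1 hval with h | h
      · exact absurd h hc
      · exact pow_eq_zero_iff hd.ne' |>.1 h
    have : ζ₀ = 0 := by
      ext j
      fin_cases j
      · exact ha
      · exact hb
    rw [this, norm_zero] at hζ1
    exact zero_ne_one hζ1
  refine ⟨?_, ?_, ζ₀ 1 / ζ₀ 0, ?_⟩
  · filter_upwards [h0.eventually_ne ha] with i hi h
    simp [ζ, h] at hi
  · have h2 := hr.mul (h0.inv₀ ha)
    rw [zero_mul] at h2
    refine h2.congr' ?_
    filter_upwards [hr0] with i hi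
    simp only [ζ, Pi.smul_apply, smul_eq_mul, mul_inv]
    exact mul_inv_cancel_left₀ hi _
  · refine (h1.div h0 ha).congr' ?_
    filter_upwards [hr0] with i hi
    simp only [ζ, Pi.smul_apply, smul_eq_mul, Pi.div_apply]
    exact mul_div_mul_left _ _ hi

lemma PolyPair.totalDegree_le_deg (F : PolyPair) (a : Fin 2) : (F a).totalDegree ≤ F.deg := by
  fin_cases a
  · exact le_max_left _ _
  · exact le_max_right _ _

lemma PolyPair.YDegreeCondition.deg_eq {F : PolyPair} (hF : F.YDegreeCondition) (a : Fin 2) :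
    F.deg = (F a).degreeOf 1 := by
  fin_cases a
  · exact hF.1
  · exact hF.2

theorem PolyPair.YDegreeCondition.hasLimitChart {F : PolyPair} (hF : F.YDegreeCondition)
    (hd : 0 < F.deg) {w : Fin 2 → ℂ} (hw : w ∈ F.asymptoticVariety) :
    HasLimitChart (fun a => chartAtInfinity F.deg (F a)) F.deg w := by
  obtain ⟨γ, -, hγ, hlim⟩ := hw
  let u : Ultrafilter ℝ := Ultrafilter.of atTop
  have hu : (u : Filter ℝ) ≤ atTop := Ultrafilter.of_le _
  rw [tendsto_pi_nhds] at hlim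
  have hc : ∀ a, (F a).coeff (Finsupp.single 1 F.deg) ≠ 0 := fun a =>
    coeff_single_ne_zero hd (F.totalDegree_le_deg a) (hF.deg_eq a)
  obtain ⟨h0, hinv, c, hslope⟩ := exists_tendsto_slope u hd (F.totalDegree_le_deg 0) (hc 0)
    (hγ.mono_left hu) ((hlim 0).mono_left hu)
  refine hasLimitChart_of_tendsto u hd ⟨0, F.deg, ?_⟩ (h0.mono fun i hi => inv_ne_zero hi)
    hinv hslope fun a => ((hlim a).mono_left hu).congr' ?_
  · rw [coeff_chartAtInfinity (F.totalDegree_le_deg 0), coeff_C_zero]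
    exact hc 0
  · filter_upwards [h0] with i hi
    have hi' := inv_ne_zero hi
    rw [evalEval_chartAtInfinity, homogEval_eq (F.totalDegree_le_deg a) hi',
      mul_div_cancel_left₀ _ (pow_ne_zero _ hi')]
    change MvPolynomial.eval (γ i) (F a) = _
    congr 1
    rw [show ![1 / (γ i 0)⁻¹, γ i 1 / γ i 0 / (γ i 0)⁻¹] = γ i from funext fun j => by
      fin_cases j
      · simp
      · simp [hi]]

end Infinity

/-! ### Primitive substitutions and the passage to asymptotic maps. -/

section Primitive

open Polynomial Filter Topology

lemma Polynomial.eq_of_eval_eq_of_ne_zero {p q : ℂ[X]} (h : ∀ t, t ≠ 0 → p.eval t = q.eval t) :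
    p = q :=
  eq_of_infinite_eval_eq p q ((Set.finite_singleton (0 : ℂ)).infinite_compl.mono fun t ht => h t ht)

lemma Polynomial.expand_contract_of_coeff {g : ℕ} (hg : 0 < g) {q : ℂ[X]}
    (h : ∀ n, q.coeff n ≠ 0 → g ∣ n) : expand ℂ g (contract g q) = q := by
  ext n
  rw [coeff_expand hg]
  split_ifs with hn
  · rw [coeff_contract hg.ne', Nat.div_mul_cancel hn]
  · by_contra h'
    exact hn (h n (Ne.symm h'))

lemma Polynomial.dvd_of_coeff_ne_zero_of_invariant {g : ℕ} {ζ : ℂ} (hζ : IsPrimitiveRoot ζ g)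
    {q : ℂ[X]} (h : ∀ t, t ≠ 0 → q.eval (ζ * t) = q.eval t) {n : ℕ} (hn : q.coeff n ≠ 0) :
    g ∣ n := by
  have h1 : q.comp (C ζ * X) = q :=
    eq_of_eval_eq_of_ne_zero fun t ht => by simpa [eval_comp] using h t ht
  have h2 := congrArg (fun p => p.coeff n) h1
  simp only [comp_C_mul_X_coeff] at h2
  exact (hζ.pow_eq_one_iff_dvd n).1 (mul_left_cancel₀ hn (by rw [h2, mul_one]))

lemma evalEval_map_expand (p : ℂ[X][X]) (g : ℕ) (t y : ℂ) :
    (p.map (expand ℂ g).toRingHom).evalEval t y = p.evalEval (t ^ g) y := by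
  induction p using Polynomial.induction_on' with
  | add p q hp hq => rw [Polynomial.map_add, evalEval_add, evalEval_add, hp, hq]
  | monomial n q => simp [evalEval, eval_monomial, expand_eval]

lemma evalEval_eq_eval_map (p : ℂ[X][X]) (t y : ℂ) :
    p.evalEval t y = (p.map (evalRingHom t)).eval y := by
  rw [eval_map, ← eval₂_evalRingHom]

/-- A polynomial invariant under multiplication of the inner variable by roots of unity. -/
lemma exists_map_expand_eq {g : ℕ} (hg : 0 < g) {ζ : ℂ} (hζ : IsPrimitiveRoot ζ g) (p : ℂ[X][X])
    (h : ∀ t y, t ≠ 0 → p.evalEval (ζ * t) y = p.evalEval t y) :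
    ∃ q : ℂ[X][X], q.map (expand ℂ g).toRingHom = p := by
  have hmem : p ∈ lifts (expand ℂ g).toRingHom := by
    rw [lifts_iff_coeff_lifts]
    intro j
    refine ⟨contract g (p.coeff j), expand_contract_of_coeff hg fun n hn =>
      dvd_of_coeff_ne_zero_of_invariant hζ (fun t ht => ?_) hn⟩
    have h1 : p.map (evalRingHom (ζ * t)) = p.map (evalRingHom t) :=
      Polynomial.funext fun y => by
        rw [← evalEval_eq_eval_map, ← evalEval_eq_eval_map, h t y ht]
    have h2 := congrArg (fun p => p.coeff j) h1
    simpa only [coeff_map, coe_evalRingHom] using h2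
  exact (mem_lifts p).1 hmem

/-- The substitution in `HasLimitChart` can be chosen primitive. -/
theorem HasLimitChart.exists_primitive {G : Fin 2 → ℂ[X][X]} {e : ℕ} {w : Fin 2 → ℂ}
    (h : HasLimitChart G e w) :
    ∃ (α k : ℕ) (φ : ℂ[X]) (H : Fin 2 → ℂ[X][X]) (y₀ : ℂ), 0 < α ∧ φ.degree < (k : ℕ) ∧
      Nat.gcd α (Nat.gcd k (φ.support.gcd id)) = 1 ∧
      (∀ a t y, t ≠ 0 → (G a).evalEval (t ^ α) (φ.eval t + t ^ k * y) =
        t ^ (α * e) * (H a).evalEval t y) ∧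
      (∃ a j, 0 < j ∧ ((H a).coeff j).coeff 0 ≠ 0) ∧ ∀ a, (H a).evalEval 0 y₀ = w a := by
  obtain ⟨α, k, φ, H, y₀, hα, -, hφ, hH, ⟨a₀, j₀, hj₀, hne⟩, hw⟩ := h
  set g := Nat.gcd α (Nat.gcd k (φ.support.gcd id)) with hgdef
  have hg : 0 < g := Nat.gcd_pos_of_pos_left _ hα
  obtain ⟨α', hα'⟩ : g ∣ α := Nat.gcd_dvd_left _ _
  obtain ⟨k', hk'⟩ : g ∣ k := (Nat.gcd_dvd_right _ _).trans (Nat.gcd_dvd_left _ _)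
  have hsupp : ∀ n, φ.coeff n ≠ 0 → g ∣ n := fun n hn =>
    ((Nat.gcd_dvd_right _ _).trans (Nat.gcd_dvd_right _ _)).trans
      (Finset.gcd_dvd (f := id) (mem_support_iff.2 hn))
  have hφ' := expand_contract_of_coeff hg hsupp
  have hφeval : ∀ t, φ.eval t = (contract g φ).eval (t ^ g) := by
    intro t
    conv_lhs => rw [← hφ', expand_eval]
  have hζ := Complex.isPrimitiveRoot_exp g hg.ne'
  set ζ := Complex.exp (2 * Real.pi * Complex.I / g)
  have hζg : ζ ^ g = 1 := hζ.pow_eq_one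
  have hζ0 : ζ ≠ 0 := hζ.ne_zero hg.ne'
  -- The substitution and the factor `t ^ (α * e)` depend on `t` only through `t ^ g`, so `H` is
  -- invariant under `t ↦ ζ * t` and is a polynomial in `t ^ g`.
  have hinv : ∀ a t y, t ≠ 0 → (H a).evalEval (ζ * t) y = (H a).evalEval t y := by
    intro a t y ht
    have h1 := hH a t y ht
    have h2 := hH a (ζ * t) y (mul_ne_zero hζ0 ht)
    have h3 : ∀ n, g ∣ n → (ζ * t) ^ n = t ^ n := by
      rintro n ⟨n', rfl⟩
      rw [mul_pow, pow_mul ζ, hζg, one_pow, one_mul]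
    rw [h3 α ⟨α', hα'⟩, h3 k ⟨k', hk'⟩, hφeval, h3 g dvd_rfl, ← hφeval,
      h3 (α * e) (Dvd.dvd.mul_right ⟨α', hα'⟩ e), h1] at h2
    exact (mul_left_cancel₀ (pow_ne_zero _ ht) h2).symm
  choose H' hH' using fun a => exists_map_expand_eq hg hζ (H a) (hinv a)
  have hHe : ∀ a t y, (H a).evalEval t y = (H' a).evalEval (t ^ g) y := by
    intro a t y
    rw [← hH', evalEval_map_expand]
  refine ⟨α', k', contract g φ, H', y₀, ?_, ?_, ?_, fun a t y ht => ?_, ⟨a₀, j₀, hj₀, ?_⟩,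
    fun a => ?_⟩
  · rcases Nat.eq_zero_or_pos α' with h | h
    · rw [h] at hα'; omega
    · exact h
  · rw [degree_lt_iff_coeff_zero] at hφ ⊢
    intro n hn
    rw [coeff_contract hg.ne']
    apply hφ
    rw [hk', mul_comm]
    exact Nat.mul_le_mul_right g hn
  · set g' := Nat.gcd α' (Nat.gcd k' ((contract g φ).support.gcd id))
    -- A common factor `g'` of the reduced exponents makes `g * g'` a common factor of the original
    -- ones.
    have h1 : g * g' ∣ g := by
      conv_rhs => rw [hgdef]
      refine Nat.dvd_gcd ?_ (Nat.dvd_gcd ?_ (Finset.dvd_gcd fun n hn => ?_))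
      · rw [hα']
        exact Nat.mul_dvd_mul_left g (Nat.gcd_dvd_left _ _)
      · rw [hk']
        exact Nat.mul_dvd_mul_left g ((Nat.gcd_dvd_right _ _).trans (Nat.gcd_dvd_left _ _))
      · obtain ⟨n', rfl⟩ := hsupp n (mem_support_iff.1 hn)
        refine Nat.mul_dvd_mul_left g (((Nat.gcd_dvd_right _ _).trans
          (Nat.gcd_dvd_right _ _)).trans (Finset.gcd_dvd (f := id) ?_))
        rw [mem_support_iff, coeff_contract hg.ne', mul_comm]
        exact mem_support_iff.1 hn
    have h2 := Nat.le_of_dvd hg h1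
    have h3 : g' ≤ 1 := by
      by_contra! h
      have := Nat.mul_lt_mul_of_pos_left h hg
      omega
    have h4 : g' ≠ 0 := by
      intro h
      rw [h, mul_zero, zero_dvd_iff] at h1
      omega
    omega
  · obtain ⟨s, rfl⟩ := IsAlgClosed.exists_pow_nat_eq t hg
    have hs : s ≠ 0 := by
      rintro rfl
      exact ht (zero_pow hg.ne')
    rw [← hHe, ← hφeval, ← pow_mul, ← pow_mul, ← pow_mul, ← hα', ← hk', ← mul_assoc, ← hα']
    exact hH a s y hs
  · rw [← hH', coeff_map] at hne
    change (expand ℂ g _).coeff 0 ≠ 0 at hne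
    simpa [coeff_expand hg] using hne
  · rw [← hw, hHe, zero_pow hg.ne']

/-- A pole bound: compare the terms of highest degree in `y`. -/
lemma le_of_evalEval_eq {p H : ℂ[X][X]} {d α k : ℕ} {φ : ℂ[X]} {c : ℂ} (hd : 0 < d) (hc : c ≠ 0)
    (hdeg : p.natDegree ≤ d) (hp : p.coeff d = C c)
    (h : ∀ t y, t ≠ 0 → p.evalEval (t ^ α) (φ.eval t + t ^ k * y) =
      t ^ (α * d) * H.evalEval t y) : α ≤ k := by
  by_contra! hlt
  have h1 : ∀ t, t ≠ 0 → c * t ^ (k * d) = t ^ (α * d) * (H.coeff d).eval t := by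
    intro t ht
    have h2 : (p.map (evalRingHom (t ^ α))).comp (C (t ^ k) * X + C (φ.eval t)) =
        C (t ^ (α * d)) * H.map (evalRingHom t) := by
      refine Polynomial.funext fun y => ?_
      rw [eval_mul, eval_C, ← evalEval_eq_eval_map, ← h t y ht, evalEval_eq_eval_map, eval_comp]
      simp [add_comm]
    have h3 := congrArg (fun q => q.coeff d) h2
    simp only [coeff_C_mul, coeff_map, coe_evalRingHom] at h3
    rw [← h3]
    have hnat : (C (t ^ k) * X + C (φ.eval t)).natDegree = 1 :=
      natDegree_linear (pow_ne_zero k ht)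
    have h4 := coeff_comp_degree_mul_degree (p := p.map (evalRingHom (t ^ α)))
      (q := C (t ^ k) * X + C (φ.eval t)) (by rw [hnat]; exact one_ne_zero)
    have hpd : (p.map (evalRingHom (t ^ α))).coeff d = c := by
      rw [coeff_map, hp, coe_evalRingHom, eval_C]
    have hnp : (p.map (evalRingHom (t ^ α))).natDegree = d :=
      le_antisymm ((natDegree_map_le).trans hdeg)
        (le_natDegree_of_ne_zero (by rw [hpd]; exact hc))
    rw [hnat, mul_one, leadingCoeff, hnp, hpd, leadingCoeff_linear (pow_ne_zero k ht),
      ← pow_mul] at h4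
    exact h4.symm
  -- The identity for `t ≠ 0` is one of polynomials; if `k < α`, its right side has no term of
  -- degree `k * d`.
  have h5 : C c * X ^ (k * d) = X ^ (α * d) * H.coeff d :=
    eq_of_eval_eq_of_ne_zero fun t ht => by simpa using h1 t ht
  have h6 := congrArg (fun q => q.coeff (k * d)) h5
  have h7 : k * d < α * d := Nat.mul_lt_mul_of_pos_right hlt hd
  simp only [coeff_C_mul, coeff_X_pow, if_true, mul_one, coeff_X_pow_mul', if_neg h7.not_ge] at h6
  exact hc h6

/-- `G` restricts to a nonconstant polynomial curve on the line `X = 0`. -/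
def PolyPair.NonconstantOnLine (G : PolyPair) (r : Fin 2 → ℂ[X]) : Prop :=
  (∃ a, 0 < (r a).natDegree) ∧ ∀ y a, G.map ![0, y] a = (r a).eval y

/-- A polynomial in `ℂ[X][Y]` as a polynomial in two variables. -/
noncomputable def Polynomial.toMvPolynomialTwo (p : ℂ[X][X]) : MvPolynomial (Fin 2) ℂ :=
  p.eval₂ (aeval (MvPolynomial.X 0 : MvPolynomial (Fin 2) ℂ)).toRingHom (MvPolynomial.X 1)

lemma Polynomial.eval_toMvPolynomialTwo (p : ℂ[X][X]) (z : Fin 2 → ℂ) :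
    MvPolynomial.eval z p.toMvPolynomialTwo = p.evalEval (z 0) (z 1) := by
  rw [toMvPolynomialTwo, hom_eval₂, ← eval₂_evalRingHom, MvPolynomial.eval_X]
  congr 1
  ext
  · simp
  · simp

/-- With `X = t ^ (-α)` and `Y = u * X`, the chart `u = φ(t) + t ^ k * y` reads `Y = t ^ (k - α) * y
+ t ^ (-α) * φ(t)`; the pole bound makes `β = k - α` a natural number. -/
theorem PolyPair.YDegreeCondition.exists_asymptoticMap {F : PolyPair} (hF : F.YDegreeCondition)
    (hd : 0 < F.deg) {w : Fin 2 → ℂ} (hw : w ∈ F.asymptoticVariety) :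
    ∃ (R : AsymptoticMap) (G : PolyPair) (r : Fin 2 → ℂ[X]), R.IsDual F G ∧
      G.NonconstantOnLine r ∧ ∃ y₀, w = G.map ![0, y₀] := by
  obtain ⟨α, k, φ, H, y₀, hα, hφ, hprim, hH, ⟨a₀, j₀, hj₀, hne⟩, hw⟩ :=
    (hF.hasLimitChart hd hw).exists_primitive
  have hαk : α ≤ k := le_of_evalEval_eq hd
    (coeff_single_ne_zero hd (F.totalDegree_le_deg 0) (hF.deg_eq 0))
    (natDegree_chartAtInfinity_le (F.totalDegree_le_deg 0))
    (coeff_chartAtInfinity (F.totalDegree_le_deg 0)) (hH 0)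
  obtain ⟨β, rfl⟩ := Nat.exists_eq_add_of_le hαk
  have hG : ∀ a z, PolyPair.map (fun a => (H a).toMvPolynomialTwo) z a =
      (H a).evalEval (z 0) (z 1) := fun a z => eval_toMvPolynomialTwo _ _
  refine ⟨⟨α, β, φ, hα, hφ, hprim⟩, fun a => (H a).toMvPolynomialTwo,
    fun a => (H a).map (evalRingHom 0), ?_, ⟨⟨a₀, ?_⟩, ?_⟩, y₀, ?_⟩
  · intro z hz
    have hz0 : z 0 ≠ 0 := hz
    funext a
    have h1 := hH a (z 0) (z 1) hz0
    have h2 := pow_ne_zero α hz0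
    rw [evalEval_chartAtInfinity, homogEval_eq (F.totalDegree_le_deg a) h2, ← pow_mul] at h1
    rw [hG, ← mul_left_cancel₀ (pow_ne_zero _ hz0) h1]
    change _ = MvPolynomial.eval _ (F a)
    congr 2
    simp only [AsymptoticMap.map]
    congr 1
    · simp
    · congr 1
      field_simp
      ring
  · refine lt_of_lt_of_le hj₀ (le_natDegree_of_ne_zero ?_)
    rwa [coeff_map, coe_evalRingHom, ← coeff_zero_eq_eval_zero]
  · intro y a
    rw [hG, evalEval_eq_eval_map]
    rfl
  · funext a
    rw [hG, ← hw]
    rfl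

end Primitive

/-! ### Parametrized plane curves and irreducible components. -/

section PlaneCurves

open Polynomial

/-- This is the Nullstellensatz for the prime ideal `(H)`. -/
lemma MvPolynomial.irreducible_dvd_of_zeroLocus_subset {H f : MvPolynomial (Fin 2) ℂ}
    (hH : Irreducible H) (h : ∀ z, MvPolynomial.eval z H = 0 → MvPolynomial.eval z f = 0) :
    H ∣ f := by
  have hp : (Ideal.span {H}).IsPrime := (Ideal.span_singleton_prime hH.ne_zero).2 hH.prime
  rw [← Ideal.mem_span_singleton,
    ← MvPolynomial.IsPrime.vanishingIdeal_zeroLocus (K := ℂ) (Ideal.span {H})]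
  intro z hz
  rw [MvPolynomial.aeval_eq_eval]
  apply h
  have := hz H (Ideal.mem_span_singleton_self H)
  rwa [MvPolynomial.aeval_eq_eval] at this

/-- The polynomial ring `ℂ[X]` is integral over the image of a nonconstant polynomial curve. -/
lemma isIntegral_aeval_curve {r : Fin 2 → ℂ[X]} {a : Fin 2} (ha : 0 < (r a).natDegree) :
    (MvPolynomial.aeval r : MvPolynomial (Fin 2) ℂ →ₐ[ℂ] ℂ[X]).toRingHom.IsIntegral := by
  set ψ := (MvPolynomial.aeval r : MvPolynomial (Fin 2) ℂ →ₐ[ℂ] ℂ[X]).toRingHom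
  have hψX : ψ (MvPolynomial.X a) = r a := MvPolynomial.aeval_X r a
  have hψC : ∀ c, ψ (MvPolynomial.C c) = C c := fun c => MvPolynomial.aeval_C r c
  have hr0 : (r a).leadingCoeff ≠ 0 := by
    rw [leadingCoeff_ne_zero]
    rintro h
    simp [h] at ha
  have hX : ψ.IsIntegralElem X := by
    let q : (MvPolynomial (Fin 2) ℂ)[X] := (C (r a).leadingCoeff⁻¹ * r a).map MvPolynomial.C
    have hq : q.Monic := by
      refine Monic.map _ ?_
      rw [Monic, leadingCoeff_mul, leadingCoeff_C, inv_mul_cancel₀ hr0]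
    have hqdeg : q.natDegree = (r a).natDegree := by
      rw [natDegree_map_eq_of_injective (MvPolynomial.C_injective _ _),
        natDegree_C_mul (inv_ne_zero hr0)]
    refine ⟨q - C (MvPolynomial.C (r a).leadingCoeff⁻¹ * MvPolynomial.X a), ?_, ?_⟩
    · refine hq.sub_of_left (degree_C_le.trans_lt ?_)
      rw [degree_eq_natDegree hq.ne_zero, hqdeg]
      exact_mod_cast ha
    · have hcomp : ψ.comp MvPolynomial.C = C := RingHom.ext hψC
      rw [eval₂_sub, eval₂_C, eval₂_map, hcomp, map_mul, hψC, hψX, eval₂_C_X, sub_self]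
  intro p
  induction p using Polynomial.induction_on with
  | C c => rw [← hψC]; exact ψ.isIntegralElem_map
  | add p q hp hq => exact hp.add ψ hq
  | monomial n c h => rw [pow_succ, ← mul_assoc]; exact h.mul ψ hX

/-- The image of a nonconstant polynomial curve is an irreducible plane curve. -/
theorem isIrreduciblePlaneCurve_range {r : Fin 2 → ℂ[X]} (hr : ∃ a, 0 < (r a).natDegree) :
    IsIrreduciblePlaneCurve {z | ∃ y, ∀ a, z a = (r a).eval y} := by
  obtain ⟨a, ha⟩ := hr
  let ψ : MvPolynomial (Fin 2) ℂ →ₐ[ℂ] ℂ[X] := MvPolynomial.aeval r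
  have hψ : ∀ f y, (ψ f).eval y = MvPolynomial.eval (fun b => (r b).eval y) f := by
    intro f y
    have h : ((evalRingHom y).comp ψ.toRingHom) = MvPolynomial.eval fun b => (r b).eval y := by
      apply MvPolynomial.ringHom_ext
      · intro c
        simp [ψ]
      · intro b
        simp [ψ]
    exact congrArg (fun g : MvPolynomial (Fin 2) ℂ →+* ℂ => g f) h
  let P : Ideal (MvPolynomial (Fin 2) ℂ) := RingHom.ker ψ.toRingHom
  have hPmem : ∀ f, f ∈ P ↔ ψ f = 0 := fun f => Iff.rfl
  have hP : P.IsPrime := RingHom.ker_isPrime _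
  have hP0 : P ≠ ⊥ := by
    intro h
    have hinj : Function.Injective ψ := (RingHom.injective_iff_ker_eq_bot ψ.toRingHom).2 h
    have h1 : AlgebraicIndependent ℂ r := hinj
    have h2 := h1.cardinalMk_le_trdeg
    rw [Polynomial.trdeg_of_isDomain, Cardinal.mk_fin] at h2
    norm_num at h2
  obtain ⟨H, hHP, hH⟩ := hP.exists_mem_prime_of_ne_bot hP0
  have hHprime : (Ideal.span {H}).IsPrime := (Ideal.span_singleton_prime hH.ne_zero).2 hH
  have hle : Ideal.span {H} ≤ P := (Ideal.span_singleton_le_iff_mem _).2 hHP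
  -- Otherwise `0 < (H) < P < m` would be a chain of primes of length three in a ring of dimension
  -- two. The last inclusion is strict because a maximal kernel would make the curve constant.
  have hPH : Ideal.span {H} = P := by
    by_contra hne
    have hlt : Ideal.span {H} < P := lt_of_le_of_ne hle hne
    obtain ⟨m, hm, hPm⟩ := P.exists_le_maximal hP.ne_top
    have hPm' : P < m := by
      refine lt_of_le_of_ne hPm fun h => ?_
      obtain ⟨z, hz⟩ := (MvPolynomial.isMaximal_iff_eq_vanishingIdeal_singleton).1 (h ▸ hm)
      have h1 : MvPolynomial.X a - MvPolynomial.C (z a) ∈ P := by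
        rw [hz]
        intro x hx
        rw [Set.mem_singleton_iff.1 hx]
        simp
      rw [hPmem] at h1
      have h2 : r a = C (z a) := by
        have : ψ (MvPolynomial.X a - MvPolynomial.C (z a)) = r a - C (z a) := by simp [ψ]
        rw [this] at h1
        exact sub_eq_zero.1 h1
      rw [h2, natDegree_C] at ha
      exact lt_irrefl _ ha
    have hbot : (⊥ : Ideal (MvPolynomial (Fin 2) ℂ)) < Ideal.span {H} := by
      rw [bot_lt_iff_ne_bot, Ne, Ideal.span_singleton_eq_bot]
      exact hH.ne_zero
    have h1 := Ideal.height_add_one_le_of_lt_of_isPrime hbot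
    have h2 := Ideal.height_add_one_le_of_lt_of_isPrime hlt
    have h3 := Ideal.height_add_one_le_of_lt_of_isPrime hPm'
    have h4 : (m.height : WithBot ℕ∞) ≤ ringKrullDim (MvPolynomial (Fin 2) ℂ) :=
      Ideal.height_le_ringKrullDim_of_isPrime
    rw [MvPolynomial.ringKrullDim_of_isNoetherianRing, ringKrullDim_eq_zero_of_field, zero_add,
      Nat.card_fin] at h4
    have h5 : m.height ≤ 2 := WithBot.coe_le_coe.1
      (h4 : (m.height : WithBot ℕ∞) ≤ ((2 : ℕ∞) : WithBot ℕ∞))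
    have h6 : (3 : ℕ∞) ≤ m.height := by
      calc (3 : ℕ∞) = 0 + 1 + 1 + 1 := by norm_num
        _ ≤ (⊥ : Ideal (MvPolynomial (Fin 2) ℂ)).height + 1 + 1 + 1 := by gcongr; exact zero_le
        _ ≤ (Ideal.span {H}).height + 1 + 1 := by gcongr
        _ ≤ P.height + 1 := by gcongr
        _ ≤ m.height := h3
    have h7 : (3 : ℕ∞) ≤ 2 := h6.trans h5
    norm_num at h7
  refine ⟨H, hH.irreducible, Set.ext fun z => ⟨?_, fun hz => ?_⟩⟩
  · rintro ⟨y, hy⟩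
    have hz : z = fun b => (r b).eval y := funext hy
    rw [Set.mem_ofPred_eq, hz, ← hψ, (hPmem H).1 hHP, eval_zero]
  · let _ : Algebra (MvPolynomial (Fin 2) ℂ) ℂ[X] := ψ.toRingHom.toAlgebra
    have : Algebra.IsIntegral (MvPolynomial (Fin 2) ℂ) ℂ[X] := ⟨isIntegral_aeval_curve ha⟩
    have hzP : P ≤ MvPolynomial.vanishingIdeal ℂ {z} := by
      rw [← hPH, Ideal.span_singleton_le_iff_mem]
      intro x hx
      rw [Set.mem_singleton_iff.1 hx, MvPolynomial.aeval_eq_eval]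
      exact hz
    have : (MvPolynomial.vanishingIdeal ℂ {z}).IsMaximal :=
      (MvPolynomial.isMaximal_iff_eq_vanishingIdeal_singleton).2 ⟨z, rfl⟩
    -- Lying over: the maximal ideal of a zero `z` of `H` lifts to `ℂ[X]`, and a root of a generator
    -- of the lift is a parameter value mapping to `z`.
    obtain ⟨Q, hQ, hQz⟩ := Ideal.exists_ideal_over_maximal_of_isIntegral
      (S := ℂ[X]) (MvPolynomial.vanishingIdeal ℂ {z}) hzP
    obtain ⟨q, hq⟩ := IsPrincipalIdealRing.principal Q
    have hq' : Q = Ideal.span {q} := hq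
    have hqdeg : q.degree ≠ 0 := by
      intro h
      apply hQ.ne_top
      rw [hq', Ideal.span_singleton_eq_top]
      exact isUnit_iff_degree_eq_zero.2 h
    obtain ⟨y, hy⟩ := IsAlgClosed.exists_root q hqdeg
    refine ⟨y, fun b => ?_⟩
    have h1 : MvPolynomial.X b - MvPolynomial.C (z b) ∈ MvPolynomial.vanishingIdeal ℂ {z} := by
      intro x hx
      rw [Set.mem_singleton_iff.1 hx]
      simp
    rw [← hQz, Ideal.mem_comap, hq', Ideal.mem_span_singleton] at h1
    have h2 := eval_dvd (x := y) h1
    rw [hy.eq_zero, zero_dvd_iff] at h2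
    have h3 : (ψ (MvPolynomial.X b - MvPolynomial.C (z b))).eval y = 0 := h2
    rw [hψ] at h3
    simp only [map_sub, MvPolynomial.eval_X, MvPolynomial.eval_C] at h3
    exact (sub_eq_zero.1 h3).symm

lemma isIrreducibleAlgebraicSubset_of_curve {S : Set (Fin 2 → ℂ)} (hS : IsIrreduciblePlaneCurve S)
    (hne : S.Nonempty) : IsIrreducibleAlgebraicSubset S := by
  obtain ⟨H, hH, rfl⟩ := hS
  refine ⟨⟨{H}, by simp⟩, hne, ?_⟩
  rintro _ _ ⟨I₁, rfl⟩ ⟨I₂, rfl⟩ hsub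
  by_contra! h
  obtain ⟨h1, h2⟩ := h
  obtain ⟨z₁, hz₁, hz₁'⟩ := Set.not_subset.1 h1
  obtain ⟨z₂, hz₂, hz₂'⟩ := Set.not_subset.1 h2
  simp only [Set.mem_ofPred_eq, not_forall] at hz₁' hz₂'
  obtain ⟨f₁, hf₁, hne₁⟩ := hz₁'
  obtain ⟨f₂, hf₂, hne₂⟩ := hz₂'
  have hdvd : H ∣ f₁ * f₂ := MvPolynomial.irreducible_dvd_of_zeroLocus_subset hH fun z hz => by
    rw [map_mul]
    rcases hsub hz with h | h
    · rw [h f₁ hf₁, zero_mul]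
    · rw [h f₂ hf₂, mul_zero]
  have heval : ∀ f z, H ∣ f → MvPolynomial.eval z H = 0 → MvPolynomial.eval z f = 0 := by
    rintro _ z ⟨g, rfl⟩ hz
    rw [map_mul, hz, zero_mul]
  rcases hH.prime.dvd_or_dvd hdvd with h | h
  · exact hne₁ (heval _ _ h hz₁)
  · exact hne₂ (heval _ _ h hz₂)

lemma IsIrreduciblePlaneCurve.eq_of_subset {S T : Set (Fin 2 → ℂ)}
    (hS : IsIrreduciblePlaneCurve S) (hT : IsIrreduciblePlaneCurve T) (h : S ⊆ T) : S = T := by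
  obtain ⟨H, hH, rfl⟩ := hS
  obtain ⟨K, hK, rfl⟩ := hT
  have hdvd : H ∣ K := MvPolynomial.irreducible_dvd_of_zeroLocus_subset hH fun z hz => h hz
  obtain ⟨g, hg⟩ := (hH.associated_of_dvd hK hdvd).symm.dvd
  refine h.antisymm fun z hz => ?_
  rw [Set.mem_ofPred_eq] at hz ⊢
  rw [hg, map_mul, hz, zero_mul]

/-- The equation of such a curve divides `a`, so up to associates it is one of the finitely many
irreducible factors of `a`. -/
lemma finite_setOf_curve_subset {a : MvPolynomial (Fin 2) ℂ} (ha : a ≠ 0) :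
    {S | IsIrreduciblePlaneCurve S ∧ ∀ z ∈ S, MvPolynomial.eval z a = 0}.Finite := by
  classical
  refine (((UniqueFactorizationMonoid.factors a).toFinset.finite_toSet).image
    fun H => {z | MvPolynomial.eval z H = 0}).subset ?_
  rintro _ ⟨⟨H, hH, rfl⟩, hS⟩
  obtain ⟨K, hK, hHK⟩ := UniqueFactorizationMonoid.exists_mem_factors_of_dvd ha hH
    (MvPolynomial.irreducible_dvd_of_zeroLocus_subset hH hS)
  have hKirr := UniqueFactorizationMonoid.irreducible_of_factor K hK
  refine ⟨K, by simpa using hK, ?_⟩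
  refine IsIrreduciblePlaneCurve.eq_of_subset ⟨K, hKirr, rfl⟩ ⟨H, hH, rfl⟩ fun z hz => ?_
  obtain ⟨g, hg⟩ := hHK.symm.dvd
  rw [Set.mem_ofPred_eq] at hz ⊢
  rw [hg, map_mul, hz, zero_mul]

lemma isAlgebraicSubset_empty : IsAlgebraicSubset ∅ := ⟨{1}, by simp⟩

lemma IsAlgebraicSubset.union {S T : Set (Fin 2 → ℂ)} (hS : IsAlgebraicSubset S)
    (hT : IsAlgebraicSubset T) : IsAlgebraicSubset (S ∪ T) := by
  obtain ⟨I, rfl⟩ := hS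
  obtain ⟨J, rfl⟩ := hT
  refine ⟨{h | ∃ f ∈ I, ∃ g ∈ J, h = f * g}, Set.ext fun z => ⟨?_, fun hz => ?_⟩⟩
  · rintro (h | h) _ ⟨f, hf, g, hg, rfl⟩
    · rw [map_mul, h f hf, zero_mul]
    · rw [map_mul, h g hg, mul_zero]
  · by_contra h
    rw [Set.mem_union, not_or] at h
    simp only [Set.mem_ofPred_eq, not_forall] at h
    obtain ⟨⟨f, hf, hf0⟩, g, hg, hg0⟩ := h
    have := hz (f * g) ⟨f, hf, g, hg, rfl⟩
    rw [map_mul] at this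
    exact (mul_ne_zero hf0 hg0) this

lemma isAlgebraicSubset_sUnion {𝒦 : Set (Set (Fin 2 → ℂ))} (hfin : 𝒦.Finite)
    (h : ∀ S ∈ 𝒦, IsAlgebraicSubset S) : IsAlgebraicSubset (⋃₀ 𝒦) := by
  induction 𝒦, hfin using Set.Finite.induction_on with
  | empty => simpa using isAlgebraicSubset_empty
  | insert _ _ ih =>
    rw [Set.sUnion_insert]
    exact (h _ (Set.mem_insert _ _)).union (ih fun S hS => h S (Set.mem_insert_of_mem _ hS))

lemma IsIrreducibleAlgebraicSubset.exists_subset {S : Set (Fin 2 → ℂ)}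
    (hS : IsIrreducibleAlgebraicSubset S) {𝒦 : Set (Set (Fin 2 → ℂ))} (hfin : 𝒦.Finite)
    (h : ∀ T ∈ 𝒦, IsAlgebraicSubset T) (hsub : S ⊆ ⋃₀ 𝒦) : ∃ T ∈ 𝒦, S ⊆ T := by
  induction 𝒦, hfin using Set.Finite.induction_on with
  | empty =>
    rw [Set.sUnion_empty, Set.subset_empty_iff] at hsub
    exact absurd hsub hS.2.1.ne_empty
  | insert _ hfin ih =>
    rw [Set.sUnion_insert] at hsub
    have h' := fun T hT => h T (Set.mem_insert_of_mem _ hT)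
    rcases hS.2.2 _ _ (h _ (Set.mem_insert _ _)) (isAlgebraicSubset_sUnion hfin h') hsub with
      h1 | h1
    · exact ⟨_, Set.mem_insert _ _, h1⟩
    · obtain ⟨T, hT, hST⟩ := ih h' h1
      exact ⟨T, Set.mem_insert_of_mem _ hT, hST⟩

/-- A finite union of pairwise incomparable irreducible sets has these sets as components. -/
lemma algebraicComponents_sUnion {𝒦 : Set (Set (Fin 2 → ℂ))} (hfin : 𝒦.Finite)
    (hirr : ∀ S ∈ 𝒦, IsIrreducibleAlgebraicSubset S)
    (hinc : ∀ S ∈ 𝒦, ∀ T ∈ 𝒦, S ⊆ T → S = T) : algebraicComponents (⋃₀ 𝒦) = 𝒦 := by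
  have halg : ∀ S ∈ 𝒦, IsAlgebraicSubset S := fun S hS => (hirr S hS).1
  ext S
  constructor
  · rintro ⟨⟨hS, hsub⟩, hmax⟩
    obtain ⟨T, hT, hST⟩ := hS.exists_subset hfin halg hsub
    have := hmax ⟨hirr T hT, Set.subset_sUnion_of_mem hT⟩ hST
    rwa [hST.antisymm this]
  · intro hS
    refine ⟨⟨hirr S hS, Set.subset_sUnion_of_mem hS⟩, fun T hT hST => ?_⟩
    obtain ⟨T', hT', hTT'⟩ := hT.1.exists_subset hfin halg hT.2
    have := hinc S hS T' hT' (hST.trans hTT')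
    rw [this]
    exact hTT'

end PlaneCurves

/-! ### Finiteness, membership in the asymptotic variety, and the choice of the basis. -/

section Assembly

open Polynomial Filter Topology

/-- The polynomials `X`, `P`, `Q` are algebraically dependent, so a leading coefficient vanishes on
the set of limits of `F` along `X → ∞`. -/
theorem PolyPair.YDegreeCondition.exists_vanishing {F : PolyPair} (hF : F.YDegreeCondition)
    (hd : 0 < F.deg) :
    ∃ a : MvPolynomial (Fin 2) ℂ, a ≠ 0 ∧ ∀ w ∈ F.asymptoticVariety, MvPolynomial.eval w a = 0 := by
  let f : Fin 3 → MvPolynomial (Fin 2) ℂ := Fin.cons (MvPolynomial.X 0) F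
  have hdep : ¬ AlgebraicIndependent ℂ f := by
    intro h
    have h2 := h.cardinalMk_le_trdeg
    rw [MvPolynomial.trdeg_of_isDomain] at h2
    simp at h2
    norm_num at h2
  rw [algebraicIndependent_iff] at hdep
  push Not at hdep
  obtain ⟨Φ, hΦ, hΦ0⟩ := hdep
  -- The relation is read as a polynomial in `X` over `ℂ[P, Q]`; divided by the top power of `X`,
  -- only its leading coefficient remains in the limit `X → ∞`.
  set Ψ := MvPolynomial.finSuccEquiv ℂ 2 Φ
  have hΨ0 : Ψ ≠ 0 := by simpa [Ψ] using hΦ0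
  have hrel : ∀ z, ∑ j ∈ Finset.range (Ψ.natDegree + 1),
      MvPolynomial.eval (F.map z) (Ψ.coeff j) * z 0 ^ j = 0 := by
    intro z
    have h1 : MvPolynomial.eval (Fin.cons (z 0) (F.map z) : Fin 3 → ℂ) Φ = 0 := by
      have h2 : ((MvPolynomial.eval z).comp (MvPolynomial.aeval f).toRingHom) =
          MvPolynomial.eval (Fin.cons (z 0) (F.map z) : Fin 3 → ℂ) := by
        apply MvPolynomial.ringHom_ext
        · intro c
          simp
        · intro b
          refine Fin.cases ?_ (fun b => ?_) b
          · simp [f]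
          · simp [f, PolyPair.map]
      rw [← h2]
      change MvPolynomial.eval z (MvPolynomial.aeval f Φ) = 0
      rw [hΦ, map_zero]
    rw [MvPolynomial.eval_eq_eval_mv_eval', eval_eq_sum_range' (n := Ψ.natDegree + 1)
      (Nat.lt_succ_of_le natDegree_map_le)] at h1
    simpa only [coeff_map] using h1
  refine ⟨Ψ.leadingCoeff, leadingCoeff_ne_zero.2 hΨ0, ?_⟩
  rintro w ⟨γ, -, hγ, hlim⟩
  let u : Ultrafilter ℝ := Ultrafilter.of atTop
  have hu : (u : Filter ℝ) ≤ atTop := Ultrafilter.of_le _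
  obtain ⟨h0, hinv, -⟩ := exists_tendsto_slope u hd (F.totalDegree_le_deg 0)
    (coeff_single_ne_zero hd (F.totalDegree_le_deg 0) (hF.deg_eq 0))
    (hγ.mono_left hu) ((tendsto_pi_nhds.1 hlim 0).mono_left hu)
  have hcoeff : ∀ j, Tendsto (fun t => MvPolynomial.eval (F.map (γ t)) (Ψ.coeff j)) u
      (𝓝 (MvPolynomial.eval w (Ψ.coeff j))) := fun j =>
    ((MvPolynomial.continuous_eval (Ψ.coeff j)).tendsto w).comp (hlim.mono_left hu)
  have hsum : Tendsto (fun t => ∑ j ∈ Finset.range (Ψ.natDegree + 1),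
      MvPolynomial.eval (F.map (γ t)) (Ψ.coeff j) * (γ t 0)⁻¹ ^ (Ψ.natDegree - j)) u
      (𝓝 (∑ j ∈ Finset.range (Ψ.natDegree + 1),
        MvPolynomial.eval w (Ψ.coeff j) * 0 ^ (Ψ.natDegree - j))) :=
    tendsto_finsetSum _ fun j _ => (hcoeff j).mul (hinv.pow _)
  have hzero : ∀ᶠ t in u, ∑ j ∈ Finset.range (Ψ.natDegree + 1),
      MvPolynomial.eval (F.map (γ t)) (Ψ.coeff j) * (γ t 0)⁻¹ ^ (Ψ.natDegree - j) = 0 := by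
    filter_upwards [h0] with t ht
    have h1 := congrArg (fun x => x * (γ t 0)⁻¹ ^ Ψ.natDegree) (hrel (γ t))
    simp only [zero_mul, Finset.sum_mul] at h1
    rw [← h1]
    refine Finset.sum_congr rfl fun j hj => ?_
    have hj' := Finset.mem_range.1 hj
    obtain ⟨n, hn⟩ := Nat.exists_eq_add_of_le (Nat.le_of_lt_succ hj')
    rw [hn, Nat.add_sub_cancel_left, pow_add, mul_assoc, ← mul_assoc (γ t 0 ^ j), ← mul_pow,
      mul_inv_cancel₀ ht, one_pow, one_mul]
  have h1 := tendsto_nhds_unique hsum (tendsto_const_nhds.congr' (hzero.mono fun t ht => ht.symm))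
  rw [Finset.sum_range_succ, Finset.sum_eq_zero, zero_add, Nat.sub_self, pow_zero, mul_one] at h1
  · exact h1
  · intro j hj
    have := Finset.mem_range.1 hj
    rw [zero_pow (by omega), mul_zero]

lemma AsymptoticMap.IsDual.map_mem_asymptoticVariety {R : AsymptoticMap} {F G : PolyPair}
    (h : R.IsDual F G) (y : ℂ) : G.map ![0, y] ∈ F.asymptoticVariety := by
  -- The function `1 / (1 + t ^ 2)` is smooth and nonzero on all of `ℝ` and tends to `0`, so
  -- `R(x(t), y)` is a smooth curve going to infinity.
  let x : ℝ → ℂ := fun t => ((1 + t ^ 2 : ℝ) : ℂ)⁻¹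
  have hpos : ∀ t : ℝ, 0 < 1 + t ^ 2 := fun t => by positivity
  have hne : ∀ t : ℝ, ((1 + t ^ 2 : ℝ) : ℂ) ≠ 0 := fun t => by exact_mod_cast (hpos t).ne'
  have hx0 : ∀ t, x t ≠ 0 := fun t => inv_ne_zero (hne t)
  have hdenom : ContDiff ℝ ∞ fun t : ℝ => ((1 + t ^ 2 : ℝ) : ℂ) :=
    Complex.ofRealCLM.contDiff.comp (contDiff_const.add (contDiff_id.pow 2))
  have hx : ContDiff ℝ ∞ x := hdenom.inv hne
  have hxinv : ∀ t, (x t ^ R.α)⁻¹ = ((1 + t ^ 2 : ℝ) : ℂ) ^ R.α := by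
    intro t
    rw [← inv_pow, inv_inv]
  have hsq : Tendsto (fun t : ℝ => 1 + t ^ 2) atTop atTop :=
    tendsto_atTop_add_const_left _ _ (tendsto_pow_atTop two_ne_zero)
  have hxlim : Tendsto x atTop (𝓝 0) := by
    have := (Complex.continuous_ofReal.tendsto 0).comp (tendsto_inv_atTop_zero.comp hsq)
    simpa [x, Function.comp_def] using this
  refine ⟨fun t => R.map ![x t, y], ?_, ?_, ?_⟩
  · rw [contDiff_pi]
    intro i
    fin_cases i
    · have : (fun t => R.map ![x t, y] 0) = fun t : ℝ => ((1 + t ^ 2 : ℝ) : ℂ) ^ R.α := by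
        funext t
        simp only [AsymptoticMap.map, Matrix.cons_val_zero, hxinv]
      exact this ▸ hdenom.pow _
    · have : (fun t => R.map ![x t, y] 1) = fun t : ℝ =>
          x t ^ R.β * y + ((1 + t ^ 2 : ℝ) : ℂ) ^ R.α * R.φ.eval (x t) := by
        funext t
        simp only [AsymptoticMap.map, Matrix.cons_val_zero, Matrix.cons_val_one, hxinv]
      have hφ : ContDiff ℝ ∞ fun t => R.φ.eval (x t) :=
        by
        have := ((R.φ.contDiff_aeval (𝕜 := ℂ) ∞).restrict_scalars ℝ).comp hx
        simpa only [Function.comp_def, coe_aeval_eq_eval] using this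
      exact this ▸ (((hx.pow _).mul contDiff_const).add ((hdenom.pow _).mul hφ))
  · refine (tendsto_norm_atTop_iff_cobounded.1 ?_).trans_eq
      (Metric.cobounded_eq_cocompact)
    have h1 : Tendsto (fun t : ℝ => (1 + t ^ 2) ^ R.α) atTop atTop :=
      (tendsto_pow_atTop R.α_pos.ne').comp hsq
    refine tendsto_atTop_mono (fun t => ?_) h1
    refine le_trans (le_of_eq ?_) (norm_le_pi_norm (R.map ![x t, y]) 0)
    simp only [AsymptoticMap.map, Matrix.cons_val_zero, hxinv]
    rw [norm_pow, Complex.norm_real, Real.norm_of_nonneg (hpos t).le]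
  · have h1 : (fun t => F.map (R.map ![x t, y])) = fun t => G.map ![x t, y] := by
      funext t
      exact (h _ (hx0 t)).symm
    rw [h1, tendsto_pi_nhds]
    intro i
    refine ((MvPolynomial.continuous_eval (G i)).tendsto ![0, y]).comp ?_
    rw [tendsto_pi_nhds]
    intro j
    fin_cases j
    · exact hxlim
    · exact tendsto_const_nhds

/-- Two duals agree off `X = 0`, hence on it by continuity. This allows one fixed choice of dual for
each `R`. -/
lemma AsymptoticMap.IsDual.map_line_eq {R : AsymptoticMap} {F G G' : PolyPair}
    (h : R.IsDual F G) (h' : R.IsDual F G') (y : ℂ) : G.map ![0, y] = G'.map ![0, y] := by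
  have hlim : ∀ E : PolyPair,
      Tendsto (fun x : ℂ => E.map ![x, y]) (𝓝[≠] 0) (𝓝 (E.map ![0, y])) := by
    intro E
    have hcont : Continuous fun x : ℂ => E.map ![x, y] :=
      continuous_pi fun i => (MvPolynomial.continuous_eval (E i)).comp (by fun_prop)
    exact (hcont.tendsto 0).mono_left nhdsWithin_le_nhds
  refine tendsto_nhds_unique (hlim G) ((hlim G').congr' ?_)
  filter_upwards [self_mem_nhdsWithin] with x hx
  have hx' : ![x, y] ∉ R.sing := hx
  rw [h _ hx', h' _ hx']

lemma PolyPair.map_image_sing (G : PolyPair) (R : AsymptoticMap) :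
    G.map '' R.sing = Set.range fun y => G.map ![0, y] := by
  ext w
  constructor
  · rintro ⟨z, hz, rfl⟩
    refine ⟨z 1, congrArg G.map (funext fun j => ?_)⟩
    fin_cases j
    · exact (show z 0 = 0 from hz).symm
    · rfl
  · rintro ⟨y, rfl⟩
    exact ⟨![0, y], rfl, rfl⟩

lemma PolyPair.NonconstantOnLine.isIrreduciblePlaneCurve {G : PolyPair} {r : Fin 2 → ℂ[X]}
    (h : G.NonconstantOnLine r) (R : AsymptoticMap) :
    IsIrreduciblePlaneCurve (G.map '' R.sing) := by
  rw [G.map_image_sing]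
  convert isIrreduciblePlaneCurve_range h.1 using 1
  ext w
  constructor
  · rintro ⟨y, rfl⟩
    exact ⟨y, h.2 y⟩
  · rintro ⟨y, hy⟩
    exact ⟨y, funext fun a => (h.2 y a).trans (hy a).symm⟩

/-- A geometric basis is obtained by choosing one map for every curve in a suitable family. -/
theorem exists_geometricBasis_of_family {F : PolyPair} (S : Set AsymptoticMap)
    (G : AsymptoticMap → PolyPair) (hdual : ∀ R ∈ S, R.IsDual F (G R))
    (hfin : ((fun R => (G R).map '' R.sing) '' S).Finite)
    (hirr : ∀ R ∈ S, IsIrreducibleAlgebraicSubset ((G R).map '' R.sing))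
    (hinc : ∀ R ∈ S, ∀ R' ∈ S, (G R).map '' R.sing ⊆ (G R').map '' R'.sing →
      (G R).map '' R.sing = (G R').map '' R'.sing)
    (hcover : ∀ w ∈ F.asymptoticVariety, ∃ R ∈ S, w ∈ (G R).map '' R.sing) :
    ∃ R₀ ⊆ S, R₀.Finite ∧
      (∀ R ∈ R₀, R.IsDual F (G R)) ∧
      (∀ w ∈ F.asymptoticVariety, ∃ R ∈ R₀, ∃ y₀ : ℂ, w = (G R).map ![0, y₀]) ∧
      IsAlgebraicSubset F.asymptoticVariety ∧
      IsGeometricBasis F R₀ G ∧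
      Set.BijOn (fun R => (G R).map '' R.sing) R₀ (algebraicComponents F.asymptoticVariety) := by
  set K : AsymptoticMap → Set (Fin 2 → ℂ) := fun R => (G R).map '' R.sing
  have hA : F.asymptoticVariety = ⋃₀ (K '' S) := by
    ext w
    constructor
    · intro hw
      obtain ⟨R, hR, hwR⟩ := hcover w hw
      exact ⟨K R, ⟨R, hR, rfl⟩, hwR⟩
    · rintro ⟨_, ⟨R, hR, rfl⟩, hw⟩
      simp only [K, PolyPair.map_image_sing] at hw
      obtain ⟨y, rfl⟩ := hw
      exact (hdual R hR).map_mem_asymptoticVariety y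
  have hirr' : ∀ T ∈ K '' S, IsIrreducibleAlgebraicSubset T := by
    rintro _ ⟨R, hR, rfl⟩
    exact hirr R hR
  have hcomp : algebraicComponents F.asymptoticVariety = K '' S := by
    rw [hA]
    refine algebraicComponents_sUnion hfin hirr' ?_
    rintro _ ⟨R, hR, rfl⟩ _ ⟨R', hR', rfl⟩ h
    exact hinc R hR R' hR' h
  -- Different maps may trace the same curve; keeping one per curve gives the bijection and the
  -- cardinality.
  obtain ⟨R₀, hR₀, hbij⟩ := Set.exists_subset_bijOn S K
  have hunion : F.asymptoticVariety = ⋃ R ∈ R₀, K R := by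
    rw [hA, ← hbij.image_eq, Set.sUnion_image]
  refine ⟨R₀, hR₀, Set.Finite.of_finite_image (hbij.image_eq ▸ hfin) hbij.injOn,
    fun R hR => hdual R (hR₀ hR), fun w hw => ?_, ?_, ⟨?_, fun R hR => ?_, hunion,
    fun R hR => hdual R (hR₀ hR)⟩, hcomp ▸ hbij⟩
  · rw [hunion] at hw
    simp only [Set.mem_iUnion, K, PolyPair.map_image_sing] at hw
    obtain ⟨R, hR, y, hy⟩ := hw
    exact ⟨R, hR, y, hy.symm⟩
  · rw [hA]
    exact isAlgebraicSubset_sUnion hfin fun T hT => (hirr' T hT).1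
  · rw [hcomp, ← hbij.image_eq, hbij.injOn.encard_image]
  · rw [hcomp]
    exact ⟨R, hR₀ hR, rfl⟩

lemma isIrreducibleAlgebraicSubset_singleton (w : Fin 2 → ℂ) :
    IsIrreducibleAlgebraicSubset {w} := by
  refine ⟨⟨Set.range fun i => MvPolynomial.X i - MvPolynomial.C (w i), ?_⟩,
    Set.singleton_nonempty w, ?_⟩
  · ext z
    rw [Set.mem_singleton_iff, Set.mem_ofPred_eq, Set.forall_mem_range, funext_iff]
    refine forall_congr' fun i => ?_
    rw [map_sub, MvPolynomial.eval_X, MvPolynomial.eval_C, sub_eq_zero]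
  · intro Z₁ Z₂ _ _ h
    simpa using h

/-- The mapping `(X⁻¹, Y)`. -/
noncomputable def AsymptoticMap.inversion : AsymptoticMap where
  α := 1
  β := 0
  φ := 0
  α_pos := one_pos
  degree_lt := by simp
  primitive := Nat.gcd_one_left _

lemma PolyPair.exists_map_eq_const {F : PolyPair} (hd : F.deg = 0) : ∃ w, ∀ z, F.map z = w := by
  refine ⟨F.map 0, fun z => funext fun a => ?_⟩
  have h := F.totalDegree_le_deg a
  rw [hd, Nat.le_zero, MvPolynomial.totalDegree_eq_zero_iff_eq_C] at h
  simp only [PolyPair.map]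
  rw [h, MvPolynomial.eval_C, MvPolynomial.eval_C]

theorem theorem2p1 (F : PolyPair) (hF : F.YDegreeCondition) :
    ∃ (R₀ : Set AsymptoticMap) (G : AsymptoticMap → PolyPair),
      R₀.Finite ∧
      (∀ R ∈ R₀, R.IsDual F (G R)) ∧
      (∀ w ∈ F.asymptoticVariety, ∃ R ∈ R₀, ∃ y₀ : ℂ, w = (G R).map ![0, y₀]) ∧
      IsAlgebraicSubset F.asymptoticVariety ∧
      IsGeometricBasis F R₀ G ∧
      Set.BijOn (fun R => (G R).map '' R.sing) R₀ (algebraicComponents F.asymptoticVariety) ∧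
      (0 < F.deg → ∀ R ∈ R₀, IsIrreduciblePlaneCurve ((G R).map '' R.sing)) := by
  classical
  rcases Nat.eq_zero_or_pos F.deg with hd | hd
  · obtain ⟨w₀, hw₀⟩ := PolyPair.exists_map_eq_const hd
    have himage : ∀ R : AsymptoticMap, F.map '' R.sing = {w₀} := by
      intro R
      rw [F.map_image_sing]
      simp only [hw₀, Set.range_const]
    obtain ⟨R₀, -, h1, h2, h3, h4, h5, h6⟩ := exists_geometricBasis_of_family (F := F)
      {AsymptoticMap.inversion} (fun _ => F) (fun R _ z _ => by rw [hw₀, hw₀])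
      ((Set.finite_singleton _).image _)
      (fun R _ => by rw [himage]; exact isIrreducibleAlgebraicSubset_singleton w₀)
      (fun R _ R' _ _ => by rw [himage, himage]) (by
        rintro w ⟨γ, -, -, hlim⟩
        refine ⟨_, rfl, ?_⟩
        rw [himage]
        simp only [hw₀] at hlim
        exact (tendsto_nhds_unique tendsto_const_nhds hlim).symm)
    exact ⟨R₀, _, h1, h2, h3, h4, h5, h6, fun h => absurd h (by omega)⟩
  · let S : Set AsymptoticMap := {R | ∃ G r, R.IsDual F G ∧ G.NonconstantOnLine r}
    have hS : ∀ R, ∃ G : PolyPair, R ∈ S → ∃ r, R.IsDual F G ∧ G.NonconstantOnLine r := by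
      intro R
      by_cases h : R ∈ S
      · obtain ⟨G, r, hG⟩ := h
        exact ⟨G, fun _ => ⟨r, hG⟩⟩
      · exact ⟨F, fun h' => absurd h' h⟩
    choose G hG using hS
    have hdual : ∀ R ∈ S, R.IsDual F (G R) := fun R hR => (hG R hR).choose_spec.1
    have hcurve : ∀ R ∈ S, IsIrreduciblePlaneCurve ((G R).map '' R.sing) := fun R hR =>
      (hG R hR).choose_spec.2.isIrreduciblePlaneCurve R
    obtain ⟨a, ha, hvanish⟩ := hF.exists_vanishing hd
    obtain ⟨R₀, hR₀, h1, h2, h3, h4, h5, h6⟩ := exists_geometricBasis_of_family S G hdual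
      ((finite_setOf_curve_subset ha).subset (by
        rintro _ ⟨R, hR, rfl⟩
        refine ⟨hcurve R hR, fun z hz => hvanish z ?_⟩
        simp only [PolyPair.map_image_sing] at hz
        obtain ⟨y, rfl⟩ := hz
        exact (hdual R hR).map_mem_asymptoticVariety y))
      (fun R hR => isIrreducibleAlgebraicSubset_of_curve (hcurve R hR) (by
        rw [PolyPair.map_image_sing]
        exact Set.range_nonempty _))
      (fun R hR R' hR' => (hcurve R hR).eq_of_subset (hcurve R' hR')) (by
        intro w hw
        obtain ⟨R, G', r, hRG', hr, y₀, hy₀⟩ := hF.exists_asymptoticMap hd hw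
        have hR : R ∈ S := ⟨G', r, hRG', hr⟩
        refine ⟨R, hR, ?_⟩
        rw [PolyPair.map_image_sing]
        refine ⟨y₀, ?_⟩
        rw [hy₀]
        exact (hdual R hR).map_line_eq hRG' y₀)
    exact ⟨R₀, G, h1, h2, h3, h4, h5, h6, fun _ R hR => hcurve R (hR₀ hR)⟩

end Assembly
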